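/- Let $\beta:\mathbb R\to\mathbb R$ be a fixed (essentially) bounded measurable function and, for a real-valued $V\in H^1(\mathbb R)$ with compact support, let $H_V=-\partial_x^2+V$. For $a,b,\mu\in\mathbb R$, let $\mathcal A_1(a,b,\mu)$ be the set of real $V\in H^1(\mathbb R)$ (identified with their continuous representatives) such that $V(x)=0$ for $|x|>a$; $\|V\|_{H^1}\le b$; $H_V$ has exactly one negative eigenvalue $\lambda_V$ on $L^2(\mathbb R)$; and $\lambda_V+\mu>0$. For such $V$ let $\psi_V$ be an eigenfunction, $H_V\psi_V=\lambda_V\psi_V$, $\|\psi_V\|_2=1$, and let $k_V=\sqrt{\lambda_V+\mu}>0$. For real $k\neq0$ let $e_{V\pm}(x,k)=e^{\pm ikx}-R_V(k)[Ve^{\pm ik\,\cdot}](x)$ be the distorted plane waves, where $\varphi=R_V(k)f$ is the outgoing solution of $(H_V-k^2)\varphi=f$, i.e. the one with $\varphi'-ik\varphi\to0$ as $x\to+\infty$ and $\varphi'+ik\varphi\to0$ as $x\to-\infty$. Put $$\Gamma[V]=\frac1{16\,k_V}\sum_{\pm}\bigl|\langle\beta\psi_V,e_{V\pm}(\cdot,k_V)\rangle\bigr|^2,\qquad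 \langle f,g\rangle=\int_{\mathbb R}\overline{f}\,g\,dx .$$ Let $\eta_V^{\pm}$ be the solutions of $H_V\eta_V^\pm=0$ with $\eta_V^\pm(x)\to1$ as $x\to\pm\infty$, respectively, let $W_V(0)$ be the ($x$-independent) Wronskian of $\eta_V^+$ and $\eta_V^-$, and for $\delta>0$ let $\mathcal A_1^\delta(a,b,\mu)=\{V\in\mathcal A_1(a,b,\mu): W_V(0)^2\ge\delta\}$. **Proposition (local Lipschitz continuity of $\Gamma$).** Let $a,b,\mu\in\mathbb R$, $\delta>0$ and $V\in\mathcal A_1^\delta(a,b,\mu)$. There exist $\rho_0>0$ and a constant $C$ such that every $U\in\mathcal A_1^\delta(a,b,\mu)$ with $\|U-V\|_\infty<\rho_0$ satisfies $$|\Gamma[U]-\Gamma[V]|\le C\,\|U-V\|_\infty .$$ Besides the fixed data $\beta$ and $\mu$, the numbers $\rho_0$ and $C$ depend only on $V$ and $a$; they can be chosen independently of $b$ and $\delta$. -/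

import Mathlib

open MeasureTheory Filter Topology
open scoped ContDiff ENNReal ComplexConjugate

noncomputable section

namespace FermiGoldenRule

/-! ### Potentials in the Sobolev space `H¹(ℝ)` -/

/-- `g` is the weak (distributional) derivative of `f` on the real line. -/
def HasWeakDeriv (f g : ℝ → ℝ) : Prop :=
  LocallyIntegrable f ∧ LocallyIntegrable g ∧
    ∀ φ : ℝ → ℝ, ContDiff ℝ ∞ φ → HasCompactSupport φ →
      ∫ x, f x * deriv φ x = - ∫ x, g x * φ x

/-- `V ∈ H¹(ℝ)` and `‖V‖_{H¹} ≤ b`, where `‖V‖_{H¹}² = ‖V‖₂² + ‖V'‖₂²`. -/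
def InH1Ball (V : ℝ → ℝ) (b : ℝ) : Prop :=
  MemLp V 2 ∧ ∃ g : ℝ → ℝ, HasWeakDeriv V g ∧ MemLp g 2 ∧
    Real.sqrt ((∫ x, V x ^ 2) + ∫ x, g x ^ 2) ≤ b

/-! ### The Schrödinger operator `H_V = -∂ₓ² + V` -/

/-- `(H_V - E) u = f` on the whole line. The potentials considered below are continuous, so
solutions are taken in the classical sense: `u` is twice differentiable and
`u'' = (V - E) u - f` at every point. -/
def SolvesSchrodinger {𝕜 : Type*} [RCLike 𝕜] (V : ℝ → ℝ) (E : ℝ) (f u : ℝ → 𝕜) : Prop :=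
  Differentiable ℝ u ∧
    ∀ x, HasDerivAt (deriv u) (((V x - E : ℝ) : 𝕜) * u x - f x) x

/-- `ψ` is an `L²`-normalized eigenfunction of `H_V` with eigenvalue `E`. (For bounded continuous
`V`, such a `ψ` has `ψ'' = (V - E) ψ ∈ L²`, so it is an element of the domain `H²(ℝ)`, and conversely
every eigenfunction in `H²(ℝ)` has a representative of this form.) -/
def IsNormalizedEigenfunction (V : ℝ → ℝ) (E : ℝ) (ψ : ℝ → ℂ) : Prop :=
  SolvesSchrodinger V E 0 ψ ∧ MemLp ψ 2 ∧ eLpNorm ψ 2 volume = 1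

/-- `E` is an eigenvalue of `H_V` on `L²(ℝ)`. -/
def IsEigenvalue (V : ℝ → ℝ) (E : ℝ) : Prop :=
  ∃ ψ : ℝ → ℂ, IsNormalizedEigenfunction V E ψ

/-- The negative eigenvalue `λ_V` (used for potentials which have exactly one). -/
def boundEnergy (V : ℝ → ℝ) : ℝ :=
  Classical.epsilon fun E : ℝ => E < 0 ∧ IsEigenvalue V E

/-- The normalized bound state `ψ_V`, `H_V ψ_V = λ_V ψ_V`, `‖ψ_V‖₂ = 1`; it is determined up to a
constant phase, on which `Γ[V]` below does not depend. -/
def boundState (V : ℝ → ℝ) : ℝ → ℂ :=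
  Classical.epsilon fun ψ : ℝ → ℂ => IsNormalizedEigenfunction V (boundEnergy V) ψ

/-- The resonant wave number `k_V = √(λ_V + μ)`. -/
def resonantK (μ : ℝ) (V : ℝ → ℝ) : ℝ :=
  Real.sqrt (boundEnergy V + μ)

/-! ### Outgoing resolvent and distorted plane waves -/

/-- The outgoing radiation condition `(∂ₓ ∓ i k) φ → 0` as `x → ±∞`. -/
def IsOutgoing (k : ℝ) (φ : ℝ → ℂ) : Prop :=
  Tendsto (fun x => deriv φ x - Complex.I * k * φ x) atTop (𝓝 0) ∧
    Tendsto (fun x => deriv φ x + Complex.I * k * φ x) atBot (𝓝 0)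

/-- The outgoing resolvent `R_V(k) f` for real `k ≠ 0`: the outgoing solution `φ` of
`(H_V - k²) φ = f`, which is unique for continuous compactly supported `V` and `f`. -/
def outgoingResolvent (V : ℝ → ℝ) (k : ℝ) (f : ℝ → ℂ) : ℝ → ℂ :=
  Classical.epsilon fun φ : ℝ → ℂ => SolvesSchrodinger V (k ^ 2) f φ ∧ IsOutgoing k φ

/-- The plane wave `e^{i σ k x}`, with the sign `σ = ±1`. -/
def planeWave (σ k : ℝ) (x : ℝ) : ℂ :=
  Complex.exp (Complex.I * ((σ * k * x : ℝ) : ℂ))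

/-- The distorted plane waves `e_{V±}(·, k) = e^{± i k x} - R_V(k)[V e^{± i k x}]`
(`σ = 1` for `+` and `σ = -1` for `-`). -/
def distortedPlaneWave (V : ℝ → ℝ) (σ k : ℝ) (x : ℝ) : ℂ :=
  planeWave σ k x - outgoingResolvent V k (fun y => (V y : ℂ) * planeWave σ k y) x

/-! ### The Wronskian at zero energy -/

/-- The solution `η_V⁺` of `H_V η = 0` with `η(x) → 1` as `x → +∞`. -/
def etaPlus (V : ℝ → ℝ) : ℝ → ℝ :=
  Classical.epsilon fun η : ℝ → ℝ => SolvesSchrodinger V 0 0 η ∧ Tendsto η atTop (𝓝 1)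

/-- The solution `η_V⁻` of `H_V η = 0` with `η(x) → 1` as `x → -∞`. -/
def etaMinus (V : ℝ → ℝ) : ℝ → ℝ :=
  Classical.epsilon fun η : ℝ → ℝ => SolvesSchrodinger V 0 0 η ∧ Tendsto η atBot (𝓝 1)

/-- The Wronskian `W_V(0) = Wron(η_V⁺, η_V⁻)`; it is constant in `x` and evaluated at `x = 0`. -/
def wronskianZero (V : ℝ → ℝ) : ℝ :=
  etaPlus V 0 * deriv (etaMinus V) 0 - deriv (etaPlus V) 0 * etaMinus V 0

/-! ### Admissible potentials and the functional `Γ` -/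

/-- The admissible class `𝒜₁(a, b, μ)`. An element of `H¹(ℝ)` is identified with its continuous
representative. -/
structure Admissible (a b μ : ℝ) (V : ℝ → ℝ) : Prop where
  continuous : Continuous V
  support : ∀ x, a < |x| → V x = 0
  inH1Ball : InH1Ball V b
  oneBoundState : ∃! E : ℝ, E < 0 ∧ IsEigenvalue V E
  resonance : 0 < boundEnergy V + μ

/-- The regularized class `𝒜₁^δ(a, b, μ) = 𝒜₁(a, b, μ) ∩ {V : W_V(0)² ≥ δ}`. -/
def AdmissibleReg (δ a b μ : ℝ) (V : ℝ → ℝ) : Prop :=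
  Admissible a b μ V ∧ δ ≤ wronskianZero V ^ 2

/-- The `L²(ℝ)` inner product, conjugate linear in the first argument. -/
def innerL2 (f g : ℝ → ℂ) : ℂ :=
  ∫ x, conj (f x) * g x

/-- `Γ[V] = (16 k_V)⁻¹ ∑_± |⟨β ψ_V, e_{V±}(·, k_V)⟩|²`. -/
def Gam (β : ℝ → ℝ) (μ : ℝ) (V : ℝ → ℝ) : ℝ :=
  1 / (16 * resonantK μ V) *
    (‖innerL2 (fun x => (β x : ℂ) * boundState V x)
        (distortedPlaneWave V 1 (resonantK μ V))‖ ^ 2 +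
      ‖innerL2 (fun x => (β x : ℂ) * boundState V x)
        (distortedPlaneWave V (-1) (resonantK μ V))‖ ^ 2)

end FermiGoldenRule

end

/-! Everything reduces to one family of solutions: the Jost solution `u_z` of `u'' = (V + z²) u`
that equals `exp (z (x + a))` to the left of the support, together with the Jost function `F(z) =
u_z'(a) + z u_z(a)`, which measures the `exp (z x)` component to the right of it. For `κ > 0` the
energy `-κ²` is an eigenvalue exactly when `F(κ) = 0`, and the bound state is then a multiple of
`u_κ`. For `z = -ik` with `k ≠ 0` real, conservation of flux gives `F(z) ≠ 0`, and the wave `e_{V-}`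
is `2z exp (z a) / F(z)` times `u_z`; reflection in `x` turns `e_{V+}` into `e_{V-}`. Hence `Γ[V]`
is an explicit expression in `κ`, `k`, Jost data on `[-a, a]`, and one-sided Laplace transforms of
the bounded function `β`, which carry the exponential tails (`HasExpTails.integral_mul`).

Each ingredient is Lipschitz at `V`. Grönwall's inequality handles the Jost solutions on `[-a, a]`
(`lip_jost`), and the Laplace transforms are holomorphic in the open right half-plane
(`differentiableAt_laplaceFrom`). For the decay rate, Green's identity (`IsPotential.jostFun_mul`)
writes `F_U(κ) u_{κ₀}(a)` as `(κ - κ₀)` times a factor of real part at least `1/2`, plus an error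
`O(‖U - V‖_∞)`. The intermediate value theorem then yields a zero of `F_U` at distance `O(‖U -
V‖_∞)` from `κ₀`, and uniqueness of the negative eigenvalue of `H_U` identifies it as the decay rate
of `U` (`lip_decayRate`).

Lipschitz bounds are stated as `f - f₀ =O[l] d` along a filter on which `d → 0`, so they combine by
algebra and constants need no tracking. The filter finally used involves only `V`, `μ` and `|a| +
1`, which makes the resulting radius and constant independent of `b` and `δ`. -/

/-! ### Linear ordinary differential equations -/

/-- Picard iterates of the linear differential equation `y' = A y` with `y x₀ = c`. -/
noncomputable def picardTerm {E : Type*} [NormedAddCommGroup E] [NormedSpace ℝ E]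
    (A : ℝ → E →L[ℝ] E) (x₀ : ℝ) (c : E) : ℕ → ℝ → E
  | 0 => fun _ => c
  | n + 1 => fun x => ∫ t in x₀..x, A t (picardTerm A x₀ c n t)

section LinearODE

variable {E : Type*} [NormedAddCommGroup E] [NormedSpace ℝ E]

lemma continuous_picardTerm {A : ℝ → E →L[ℝ] E} (hA : Continuous A)
    (x₀ : ℝ) (c : E) (n : ℕ) : Continuous (picardTerm A x₀ c n) := by
  induction n with
  | zero => exact continuous_const
  | succ n ih =>
    exact intervalIntegral.continuous_primitive
      (fun _ _ => (hA.clm_apply ih).intervalIntegrable _ _) _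

/-- Each iteration integrates `|t - x₀| ^ n`, and the resulting factor `1 / (n + 1)` builds up the
factorial that makes the Picard series converge everywhere. -/
lemma norm_picardTerm_le {A : ℝ → E →L[ℝ] E} (hA : Continuous A)
    {K : ℝ} (hK : ∀ t, ‖A t‖ ≤ K) (x₀ : ℝ) (c : E) (n : ℕ) (x : ℝ) :
    ‖picardTerm A x₀ c n x‖ ≤ ‖c‖ * (K * |x - x₀|) ^ n / n.factorial := by
  have hK0 : 0 ≤ K := (norm_nonneg _).trans (hK 0)
  induction n generalizing x with
  | zero => simp [picardTerm]
  | succ n ih =>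
    calc ‖picardTerm A x₀ c (n + 1) x‖
        ≤ ∫ t in Set.uIoc x₀ x, ‖A t (picardTerm A x₀ c n t)‖ :=
          intervalIntegral.norm_integral_le_integral_norm_uIoc
      _ ≤ ∫ t in Set.uIoc x₀ x, (‖c‖ * K ^ (n + 1) / n.factorial) * |t - x₀| ^ n := by
          refine setIntegral_mono ?_ ?_ fun t => ?_
          · exact (((hA.clm_apply (continuous_picardTerm hA x₀ c n)).norm).intervalIntegrable
              x₀ x).def'
          · exact (Continuous.intervalIntegrable (by fun_prop) x₀ x).def'
          · calc _ ≤ ‖A t‖ * ‖picardTerm A x₀ c n t‖ := (A t).le_opNorm _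
              _ ≤ K * (‖c‖ * (K * |t - x₀|) ^ n / n.factorial) :=
                mul_le_mul (hK t) (ih t) (norm_nonneg _) hK0
              _ = _ := by rw [mul_pow]; ring
      _ = _ := by
          rw [integral_const_mul, integral_pow_abs_sub_uIoc, mul_pow, Nat.factorial_succ]
          push_cast
          field_simp

/-- Global solvability of a linear differential equation with continuous bounded coefficient. -/
lemma exists_hasDerivAt_linear [CompleteSpace E] {A : ℝ → E →L[ℝ] E} (hA : Continuous A)
    {K : ℝ} (hK : ∀ t, ‖A t‖ ≤ K) (x₀ : ℝ) (c : E) :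
    ∃ y : ℝ → E, y x₀ = c ∧ ∀ x, HasDerivAt y (A x (y x)) x := by
  have hK0 : 0 ≤ K := (norm_nonneg _).trans (hK 0)
  have hbd : ∀ R, Summable fun n : ℕ => ‖c‖ * (K * R) ^ n / n.factorial := fun R => by
    simpa only [mul_div_assoc] using (Real.summable_pow_div_factorial (K * R)).mul_left ‖c‖
  have hsum : ∀ x, Summable fun n => picardTerm A x₀ c n x := fun x =>
    Summable.of_norm_bounded (hbd |x - x₀|) fun n => norm_picardTerm_le hA hK x₀ c n x
  refine ⟨fun x => ∑' n, picardTerm A x₀ c n x, ?_, fun x => ?_⟩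
  · dsimp only
    rw [tsum_eq_single 0]
    · rfl
    · intro n hn
      obtain ⟨m, rfl⟩ := Nat.exists_eq_succ_of_ne_zero hn
      simp [picardTerm]
  · set R := |x - x₀| + 1 with hR
    -- Termwise differentiation of the shifted series on a ball around `x₀` containing `x`, where
    -- the Picard bounds are uniform; the zeroth term is constant and is added back at the end.
    have key : HasDerivAt (fun z => ∑' n, picardTerm A x₀ c (n + 1) z)
        (∑' n, A x (picardTerm A x₀ c n x)) x := by
      refine hasDerivAt_tsum_of_isPreconnected (y₀ := x) ((hbd R).mul_left K)
        (Metric.isOpen_ball (x := x₀) (ε := R)) (convex_ball _ _).isPreconnected ?_ ?_ ?_ ?_ ?_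
        (g' := fun n y => A y (picardTerm A x₀ c n y))
      · intro n y _
        exact intervalIntegral.integral_hasDerivAt_right
          ((hA.clm_apply (continuous_picardTerm hA x₀ c n)).intervalIntegrable _ _)
          ((hA.clm_apply (continuous_picardTerm hA x₀ c n)).stronglyMeasurableAtFilter _ _)
          (hA.clm_apply (continuous_picardTerm hA x₀ c n)).continuousAt
      · intro n y hy
        rw [Metric.mem_ball, Real.dist_eq] at hy
        calc _ ≤ ‖A y‖ * ‖picardTerm A x₀ c n y‖ := (A y).le_opNorm _
          _ ≤ K * (‖c‖ * (K * |y - x₀|) ^ n / n.factorial) :=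
            mul_le_mul (hK y) (norm_picardTerm_le hA hK x₀ c n y) (norm_nonneg _) hK0
          _ ≤ _ := by gcongr
      · simp [Real.dist_eq, hR]
      · exact (summable_nat_add_iff 1).2 (hsum x)
      · simp [Real.dist_eq, hR]
    rw [← (A x).map_tsum (hsum x)] at key
    have := key.const_add c
    refine this.congr_of_eventuallyEq (Eventually.of_forall fun z => ?_)
    exact (hsum z).tsum_eq_zero_add

end LinearODE

/-! ### Solutions of `u'' = q u` -/

/-- The coefficient matrix of the first order system equivalent to `u'' = q u`. -/
noncomputable def schroMatrix (q : ℂ) : (ℂ × ℂ) →L[ℝ] (ℂ × ℂ) :=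
  (ContinuousLinearMap.snd ℝ ℂ ℂ).prod (q • ContinuousLinearMap.fst ℝ ℂ ℂ)

@[simp] lemma schroMatrix_apply (q : ℂ) (p : ℂ × ℂ) : schroMatrix q p = (p.2, q * p.1) := rfl

lemma continuous_schroMatrix : Continuous schroMatrix := by
  have : schroMatrix = fun q => (ContinuousLinearMap.prodₗᵢ ℝ)
      (ContinuousLinearMap.snd ℝ ℂ ℂ, q • ContinuousLinearMap.fst ℝ ℂ ℂ) := rfl
  rw [this]
  exact (LinearIsometryEquiv.continuous _).comp (by fun_prop)

lemma norm_schroMatrix_le (q : ℂ) : ‖schroMatrix q‖ ≤ 1 + ‖q‖ := by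
  refine ContinuousLinearMap.opNorm_le_bound _ (by positivity) fun p => ?_
  rw [schroMatrix_apply, Prod.norm_def, Prod.norm_def, norm_mul]
  have h1 := norm_nonneg p.1
  have h2 := norm_nonneg p.2
  have h3 := norm_nonneg q
  have h4 := le_max_left ‖p.1‖ ‖p.2‖
  have h5 := le_max_right ‖p.1‖ ‖p.2‖
  refine max_le ?_ ?_ <;> nlinarith [mul_le_mul_of_nonneg_left h4 h3]

/-- `u'' = q u`, with `v = u'`. -/
def IsSol (q u v : ℝ → ℂ) : Prop :=
  ∀ x, HasDerivAt u (v x) x ∧ HasDerivAt v (q x * u x) x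

lemma exists_isSol {q : ℝ → ℂ} (hq : Continuous q) {K : ℝ} (hK : ∀ x, ‖q x‖ ≤ K) (x₀ : ℝ)
    (c c' : ℂ) : ∃ u v, IsSol q u v ∧ u x₀ = c ∧ v x₀ = c' := by
  obtain ⟨y, hy0, hy⟩ := exists_hasDerivAt_linear (A := fun x => schroMatrix (q x))
    (continuous_schroMatrix.comp hq) (K := 1 + K)
    (fun t => (norm_schroMatrix_le _).trans (by linarith [hK t])) x₀ (c, c')
  refine ⟨fun x => (y x).1, fun x => (y x).2, fun x => ⟨?_, ?_⟩, by simp [hy0], by simp [hy0]⟩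
  · exact (hasFDerivAt_fst.comp_hasDerivAt x (hy x) : _)
  · exact (hasFDerivAt_snd.comp_hasDerivAt x (hy x) : _)

lemma IsSol.hasDerivAt_prod {q u v : ℝ → ℂ} (h : IsSol q u v) (x : ℝ) :
    HasDerivAt (fun x => (u x, v x)) (schroMatrix (q x) (u x, v x)) x :=
  (h x).1.prodMk (h x).2

lemma lipschitzWith_schroMatrix {q : ℂ} {K : ℝ} (hK0 : 0 ≤ K) (hK : ‖q‖ ≤ K) :
    LipschitzWith (1 + K).toNNReal (schroMatrix q) := by
  refine (schroMatrix q).lipschitz.weaken ?_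
  rw [← NNReal.coe_le_coe, Real.coe_toNNReal _ (by positivity), coe_nnnorm]
  exact (norm_schroMatrix_le q).trans (by linarith)

lemma IsSol.unique {q u v u' v' : ℝ → ℂ} {K : ℝ} (hK : ∀ x, ‖q x‖ ≤ K)
    (h : IsSol q u v) (h' : IsSol q u' v') {x₀ : ℝ} (hu : u x₀ = u' x₀) (hv : v x₀ = v' x₀) :
    u = u' ∧ v = v' := by
  have hK0 : 0 ≤ K := (norm_nonneg _).trans (hK 0)
  have : (fun x => (u x, v x)) = fun x => (u' x, v' x) := by
    refine ODE_solution_unique_univ (v := fun x => schroMatrix (q x)) (s := fun _ => Set.univ)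
      (K := (1 + K).toNNReal) (t₀ := x₀) ?_ ?_ ?_ ?_
    · exact fun t => (lipschitzWith_schroMatrix hK0 (hK t)).lipschitzOnWith
    · exact fun t => ⟨h.hasDerivAt_prod t, trivial⟩
    · exact fun t => ⟨h'.hasDerivAt_prod t, trivial⟩
    · simp [hu, hv]
  exact ⟨funext fun x => congrArg Prod.fst (congrFun this x),
    funext fun x => congrArg Prod.snd (congrFun this x)⟩

/-- Quantitative continuous dependence on the coefficient and the initial data. -/
lemma IsSol.norm_sub_le {q u v q' u' v' : ℝ → ℂ} {s t K B ε δ : ℝ} (h : IsSol q u v)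
    (h' : IsSol q' u' v') (hK0 : 0 ≤ K) (hK : ∀ x, ‖q' x‖ ≤ K)
    (hB : ∀ x ∈ Set.Icc s t, ‖u x‖ ≤ B) (hε : 0 ≤ ε) (hq : ∀ x ∈ Set.Icc s t, ‖q' x - q x‖ ≤ ε)
    (hδ : ‖u' s - u s‖ ≤ δ ∧ ‖v' s - v s‖ ≤ δ) :
    ∀ x ∈ Set.Icc s t, ‖u' x - u x‖ ≤ (δ + ε * B) * Real.exp ((1 + K) * (t - s)) ∧
      ‖v' x - v x‖ ≤ (δ + ε * B) * Real.exp ((1 + K) * (t - s)) := by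
  intro x hx
  have hδ0 : 0 ≤ δ := (norm_nonneg _).trans hδ.1
  have hB0 : 0 ≤ B := (norm_nonneg _).trans (hB x hx)
  have hc : ∀ {q u v : ℝ → ℂ}, IsSol q u v →
      ContinuousOn (fun x => (u x, v x)) (Set.Icc s t) := fun h x _ =>
    (h.hasDerivAt_prod x).continuousAt.continuousWithinAt
  -- The unprimed pair is treated as an approximate trajectory of the primed system, with defect
  -- `‖q' - q‖ ‖u‖ ≤ ε B`.
  have hmain := dist_le_of_approx_trajectories_ODE (v := fun x => schroMatrix (q' x))
    (K := (1 + K).toNNReal) (εf := 0) (εg := ε * B) (δ := δ)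
    (fun x => lipschitzWith_schroMatrix hK0 (hK x)) (hc h')
    (fun x _ => (h'.hasDerivAt_prod x).hasDerivWithinAt) (fun x _ => by simp) (hc h)
    (fun x _ => (h.hasDerivAt_prod x).hasDerivWithinAt)
    (fun x hx => by
      have hx' := Set.Ico_subset_Icc_self hx
      rw [dist_eq_norm, schroMatrix_apply, schroMatrix_apply, Prod.norm_def]
      dsimp only [Prod.fst_sub, Prod.snd_sub]
      rw [sub_self, norm_zero, ← sub_mul, norm_mul, norm_sub_rev]
      exact max_le (by positivity) (mul_le_mul (hq x hx') (hB x hx') (norm_nonneg _) hε))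
    (by rw [dist_eq_norm, Prod.norm_def]; exact max_le hδ.1 hδ.2) x hx
  rw [gronwallBound_of_K_ne_0 (by rw [Real.coe_toNNReal _ (by positivity)]; positivity),
    Real.coe_toNNReal _ (by positivity), zero_add, dist_eq_norm, Prod.norm_def] at hmain
  have hexp : Real.exp ((1 + K) * (x - s)) ≤ Real.exp ((1 + K) * (t - s)) :=
    Real.exp_le_exp.2 (mul_le_mul_of_nonneg_left (by linarith [hx.2]) (by positivity))
  have hfin : δ * Real.exp ((1 + K) * (x - s)) +
      ε * B / (1 + K) * (Real.exp ((1 + K) * (x - s)) - 1) ≤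
        (δ + ε * B) * Real.exp ((1 + K) * (t - s)) := by
    have h1 : ε * B / (1 + K) ≤ ε * B := div_le_self (by positivity) (by linarith)
    have h2 : 0 ≤ ε * B / (1 + K) := by positivity
    have h3 := Real.exp_pos ((1 + K) * (x - s))
    have h4 := mul_le_mul_of_nonneg_left hexp hδ0
    have h5 := mul_le_mul h1 hexp h3.le (by positivity : 0 ≤ ε * B)
    linarith
  exact ⟨(le_max_left _ _).trans (hmain.trans hfin), (le_max_right _ _).trans (hmain.trans hfin)⟩

/-! ### Behaviour outside the support of the potential -/

lemma IsSol.continuous {q u v : ℝ → ℂ} (h : IsSol q u v) : Continuous u :=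
  continuous_iff_continuousAt.2 fun x => (h x).1.continuousAt

lemma IsSol.deriv_eq {q u v : ℝ → ℂ} (h : IsSol q u v) : deriv u = v :=
  funext fun x => (h x).1.deriv

lemma IsSol.const_mul {q u v : ℝ → ℂ} (h : IsSol q u v) (c : ℂ) :
    IsSol q (fun x => c * u x) (fun x => c * v x) := fun x =>
  ⟨(h x).1.const_mul c, ((h x).2.const_mul c).congr_deriv (by ring)⟩

lemma IsSol.sub {q u v u' v' : ℝ → ℂ} (h : IsSol q u v) (h' : IsSol q u' v') :
    IsSol q (fun x => u x - u' x) (fun x => v x - v' x) := fun x =>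
  ⟨(h x).1.sub (h' x).1, ((h x).2.sub (h' x).2).congr_deriv (by ring)⟩

lemma IsSol.comp_neg {q u v : ℝ → ℂ} (h : IsSol q u v) :
    IsSol (fun x => q (-x)) (fun x => u (-x)) (fun x => -v (-x)) := fun x => by
  have h1 := (h (-x)).1.scomp x (hasDerivAt_neg x)
  have h2 := ((h (-x)).2.scomp x (hasDerivAt_neg x)).neg
  exact ⟨h1.congr_deriv (by simp), h2.congr_deriv (by simp)⟩

lemma IsSol.conj {q u v : ℝ → ℂ} (h : IsSol q u v) :
    IsSol (fun x => conj (q x)) (fun x => conj (u x)) (fun x => conj (v x)) := fun x => by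
  have h1 := Complex.conjCLE.hasFDerivAt.comp_hasDerivAt x (h x).1
  have h2 := Complex.conjCLE.hasFDerivAt.comp_hasDerivAt x (h x).2
  refine ⟨?_, ?_⟩
  · simpa [Function.comp_def] using h1
  · simpa [Function.comp_def] using h2

/-- Two different coefficients are allowed: equal ones give conservation of flux, different ones
Green's identity. -/
lemma IsSol.wronskian_eq {q u v q' u' v' : ℝ → ℂ} (h : IsSol q u v) (h' : IsSol q' u' v') (x : ℝ) :
    HasDerivAt (fun x => v x * u' x - u x * v' x) ((q x - q' x) * (u x * u' x)) x := by
  exact (((h x).2.mul (h' x).1).sub ((h x).1.mul (h' x).2)).congr_deriv (by ring)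

/-- Where `q = z²` the equation factors as `(∂ + z)(∂ - z) u = 0`, so `(v - z u) exp (z (x - a))` is
constant. Using it for both `z` and `-z` recovers the two exponential components. -/
lemma IsSol.right_tail {q u v : ℝ → ℂ} (h : IsSol q u v) {a : ℝ} {z : ℂ}
    (hq : ∀ x, a ≤ x → q x = z ^ 2) {t : ℝ} (ht : 0 ≤ t) :
    v (a + t) - z * u (a + t) = (v a - z * u a) * Complex.exp (-(z * t)) := by
  have hd : ∀ x, a ≤ x → HasDerivAt
      (fun x : ℝ => (v x - z * u x) * Complex.exp (z * ((x - a : ℝ) : ℂ))) 0 x := fun x hx => by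
    have h1 := (h x).2.sub ((h x).1.const_mul z)
    have h2 : HasDerivAt (fun x : ℝ => Complex.exp (z * ((x - a : ℝ) : ℂ)))
        (Complex.exp (z * ((x - a : ℝ) : ℂ)) * (z * ((1 : ℝ) : ℂ))) x :=
      ((((hasDerivAt_id x).sub_const a).ofReal_comp).const_mul z).cexp
    refine (h1.mul h2).congr_deriv ?_
    rw [hq x hx]
    push_cast
    simp only [Pi.sub_apply]
    ring
  have hconst := constant_of_has_deriv_right_zero (a := a) (b := a + t)
    (fun x hx => (hd x hx.1).continuousAt.continuousWithinAt)
    (fun x hx => (hd x hx.1).hasDerivWithinAt) (a + t) ⟨by linarith, le_rfl⟩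
  simp only [add_sub_cancel_left, sub_self, Complex.ofReal_zero, mul_zero, Complex.exp_zero,
    mul_one] at hconst
  rw [← hconst, mul_assoc, ← Complex.exp_add]
  simp

lemma IsSol.left_tail {q u v : ℝ → ℂ} (h : IsSol q u v) {a : ℝ} {z : ℂ}
    (hq : ∀ x, x ≤ -a → q x = z ^ 2) {t : ℝ} (ht : 0 ≤ t) :
    v (-a - t) + z * u (-a - t) = (v (-a) + z * u (-a)) * Complex.exp (-(z * t)) := by
  have := h.comp_neg.right_tail (a := a) (z := z) (fun x hx => hq _ (by linarith)) ht
  rw [neg_add, ← sub_eq_add_neg] at this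
  linear_combination -this

/-- Chebyshev: the set where `1 ≤ ‖w‖` has finite measure, yet it would contain a half-line. -/
lemma not_memLp_of_tendsto_norm_atTop {w : ℝ → ℂ} (hw : MemLp w 2)
    (h : Tendsto (fun x => ‖w x‖) atTop atTop) : False := by
  have h1 := hw.meas_ge_lt_top (by norm_num) (by norm_num) (ε := 1) one_ne_zero
  obtain ⟨T, hT⟩ := (h.eventually_ge_atTop 1).exists_forall_of_atTop
  have h2 : volume (Set.Ici T) ≤ volume {x | (1 : NNReal) ≤ ‖w x‖₊} :=
    measure_mono fun x hx => by
      have := hT x hx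
      simpa [← NNReal.coe_le_coe] using this
  rw [Real.volume_Ici] at h2
  exact absurd (h2.trans_lt h1) (lt_irrefl _)

/-- The quantity `v a + κ u a` is `2κ` times the coefficient of the growing exponential; if it were
nonzero, `‖u‖` would tend to infinity. -/
lemma IsSol.decaying_of_memLp {q u v : ℝ → ℂ} (h : IsSol q u v) {a κ : ℝ} (hκ : 0 < κ)
    (hq : ∀ x, a ≤ x → q x = (κ : ℂ) ^ 2) (hu : MemLp u 2) : v a + κ * u a = 0 := by
  by_contra hne
  refine not_memLp_of_tendsto_norm_atTop hu ?_
  have h1 : ∀ t, 0 ≤ t → ‖v a + κ * u a‖ / (2 * κ) * Real.exp (κ * t) -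
      ‖v a - κ * u a‖ / (2 * κ) ≤ ‖u (a + t)‖ := fun t ht => by
    have e1 := h.right_tail hq ht
    have e2 := h.right_tail (a := a) (z := -(κ : ℂ)) (fun x hx => by rw [hq x hx]; ring) ht
    have e3 : (v a + κ * u a) * Complex.exp ((κ * t : ℝ) : ℂ) =
        2 * κ * u (a + t) + (v a - κ * u a) * Complex.exp ((-(κ * t) : ℝ) : ℂ) := by
      push_cast
      rw [← e1]
      simp only [neg_mul, neg_neg, sub_neg_eq_add] at e2
      rw [← e2]
      ring
    have e4 := congrArg norm e3
    rw [norm_mul, ← Complex.ofReal_exp, Complex.norm_real, Real.norm_of_nonneg (Real.exp_nonneg _)]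
      at e4
    have e5 : ‖v a + κ * u a‖ * Real.exp (κ * t) ≤ 2 * κ * ‖u (a + t)‖ + ‖v a - κ * u a‖ := by
      rw [e4]
      refine (norm_add_le _ _).trans (add_le_add ?_ ?_)
      · simp [abs_of_pos hκ]
      · rw [norm_mul, ← Complex.ofReal_exp, Complex.norm_real,
          Real.norm_of_nonneg (Real.exp_nonneg _)]
        exact mul_le_of_le_one_right (norm_nonneg _)
          (Real.exp_le_one_iff.2 (by simpa using mul_nonneg hκ.le ht))
    rw [div_mul_eq_mul_div, ← sub_div, div_le_iff₀ (by positivity)]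
    linarith
  have h2 : Tendsto (fun t : ℝ => ‖u (a + t)‖) atTop atTop := by
    refine tendsto_atTop_mono' _ ((eventually_ge_atTop 0).mono h1) ?_
    refine tendsto_atTop_add_const_right _ _ ?_
    refine Tendsto.const_mul_atTop (div_pos (norm_pos_iff.2 hne) (by positivity)) ?_
    exact Real.tendsto_exp_atTop.comp (tendsto_id.const_mul_atTop hκ)
  have h3 := h2.comp (tendsto_atTop_add_const_right atTop (-a) tendsto_id)
  refine h3.congr fun x => ?_
  simp

/-! ### Compactly supported potentials and their Jost solutions -/

/-- A continuous potential supported in `[-a, a]`. -/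
structure IsPotential (a : ℝ) (V : ℝ → ℝ) : Prop where
  continuous : Continuous V
  support : ∀ x, a < |x| → V x = 0

lemma IsPotential.comp_neg {a : ℝ} {V : ℝ → ℝ} (hV : IsPotential a V) :
    IsPotential a (fun x => V (-x)) :=
  ⟨hV.continuous.comp continuous_neg, fun x hx => hV.support _ (by rwa [abs_neg])⟩

/-- Continuity extends the vanishing to the endpoint `a`, where the Jost data are read off. -/
lemma IsPotential.eq_zero_of_le {a : ℝ} {V : ℝ → ℝ} (hV : IsPotential a V) {x : ℝ}
    (hx : a ≤ x) : V x = 0 := by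
  have hcl : IsClosed {x | V x = 0} := isClosed_eq hV.continuous continuous_const
  have : Set.Ici a ⊆ {x | V x = 0} := by
    rw [← closure_Ioi]
    exact hcl.closure_subset_iff.2 fun y hy => hV.support y (lt_of_lt_of_le hy (le_abs_self y))
  exact this hx

lemma IsPotential.eq_zero_of_le_neg {a : ℝ} {V : ℝ → ℝ} (hV : IsPotential a V) {x : ℝ}
    (hx : x ≤ -a) : V x = 0 := by
  simpa using hV.comp_neg.eq_zero_of_le (x := -x) (by linarith)

lemma IsPotential.exists_bound {a : ℝ} {V : ℝ → ℝ} (hV : IsPotential a V) :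
    ∃ B, 0 ≤ B ∧ ∀ x, |V x| ≤ B := by
  obtain ⟨B, hB⟩ := (isCompact_Icc (a := -a) (b := a)).exists_bound_of_continuousOn
    hV.continuous.continuousOn
  refine ⟨max B 0, le_max_right _ _, fun x => ?_⟩
  rcases le_or_gt |x| a with h | h
  · exact (hB x (abs_le.1 h)).trans (le_max_left _ _)
  · simp [hV.support x h]

lemma IsPotential.exists_bound_add {a : ℝ} {V : ℝ → ℝ} (hV : IsPotential a V) (z : ℂ) :
    ∃ B, ∀ x, ‖(V x : ℂ) + z‖ ≤ B := by
  obtain ⟨B, -, hB⟩ := hV.exists_bound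
  refine ⟨B + ‖z‖, fun x => (norm_add_le _ _).trans ?_⟩
  have := hB x
  rw [Complex.norm_real, Real.norm_eq_abs]
  linarith

/-- `u` is the solution of `u'' = (V + z²) u` which equals `exp (z (x + a))` for `x ≤ -a`, and `v` is
its derivative. -/
structure IsJost (a : ℝ) (V : ℝ → ℝ) (z : ℂ) (u v : ℝ → ℂ) : Prop where
  isSol : IsSol (fun x => (V x : ℂ) + z ^ 2) u v
  left : u (-a) = 1
  left_deriv : v (-a) = z

/-- The Jost solution and its derivative. -/
noncomputable def jostPair (a : ℝ) (V : ℝ → ℝ) (z : ℂ) : (ℝ → ℂ) × (ℝ → ℂ) :=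
  Classical.epsilon fun p => IsJost a V z p.1 p.2

/-- The Jost solution of `u'' = (V + z²) u`, equal to `exp (z (x + a))` for `x ≤ -a`. -/
noncomputable def jost (a : ℝ) (V : ℝ → ℝ) (z : ℂ) : ℝ → ℂ := (jostPair a V z).1

/-- The derivative of the Jost solution. -/
noncomputable def jostDeriv (a : ℝ) (V : ℝ → ℝ) (z : ℂ) : ℝ → ℂ := (jostPair a V z).2

/-- The Jost function; it vanishes if and only if the Jost solution is a multiple of `exp (-z x)`
for `x ≥ a`. -/
noncomputable def jostFun (a : ℝ) (V : ℝ → ℝ) (z : ℂ) : ℂ := jostDeriv a V z a + z * jost a V z a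

section Jost

variable {a : ℝ} {V : ℝ → ℝ} {z : ℂ}

lemma IsPotential.isJost (hV : IsPotential a V) (z : ℂ) :
    IsJost a V z (jost a V z) (jostDeriv a V z) := by
  obtain ⟨B, hB⟩ := hV.exists_bound_add (z ^ 2)
  have hc := hV.continuous
  obtain ⟨u, v, h, h1, h2⟩ := exists_isSol (q := fun x => (V x : ℂ) + z ^ 2) (by fun_prop) hB (-a) 1 z
  exact Classical.epsilon_spec (p := fun p : (ℝ → ℂ) × (ℝ → ℂ) => IsJost a V z p.1 p.2)
    ⟨(u, v), h, h1, h2⟩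

/-- Every solution with the left logarithmic derivative of the Jost solution is a multiple of it. -/
lemma IsPotential.eq_mul_jost (hV : IsPotential a V) {u v : ℝ → ℂ}
    (h : IsSol (fun x => (V x : ℂ) + z ^ 2) u v) (hl : v (-a) = z * u (-a)) :
    u = (fun x => u (-a) * jost a V z x) ∧ v = fun x => u (-a) * jostDeriv a V z x := by
  obtain ⟨B, hB⟩ := hV.exists_bound_add (z ^ 2)
  have hj := hV.isJost z
  refine h.unique hB (hj.isSol.const_mul (u (-a))) (x₀ := -a) ?_ ?_
  · simp [hj.left]
  · simp [hj.left_deriv, hl, mul_comm]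

/-- For real `z` the equation and the initial data are real, so conjugation fixes the solution by
uniqueness. -/
lemma IsPotential.conj_jost (hV : IsPotential a V) (hz : conj z = z) (x : ℝ) :
    conj (jost a V z x) = jost a V z x ∧ conj (jostDeriv a V z x) = jostDeriv a V z x := by
  have hj := hV.isJost z
  have h := hj.isSol.conj
  simp only [map_add, map_pow, Complex.conj_ofReal, hz] at h
  have := hV.eq_mul_jost h (by simp [hj.left, hj.left_deriv, hz])
  simp only [hj.left, map_one, one_mul] at this
  exact ⟨congrFun this.1 x, congrFun this.2 x⟩

lemma IsPotential.jost_left (hV : IsPotential a V) (hz : z ≠ 0) {t : ℝ} (ht : 0 ≤ t) :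
    jost a V z (-a - t) = Complex.exp (-(z * t)) ∧
      jostDeriv a V z (-a - t) = z * jost a V z (-a - t) := by
  have hj := hV.isJost z
  have e1 := hj.isSol.left_tail (a := a) (z := z) (fun x hx => by simp [hV.eq_zero_of_le_neg hx]) ht
  have e2 := hj.isSol.left_tail (a := a) (z := -z) (fun x hx => by simp [hV.eq_zero_of_le_neg hx]) ht
  rw [hj.left, hj.left_deriv] at e1 e2
  have e3 : jostDeriv a V z (-a - t) = z * jost a V z (-a - t) := by
    have : (z + -z * 1) = 0 := by ring
    rw [this, zero_mul] at e2
    linear_combination e2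
  refine ⟨?_, e3⟩
  rw [e3] at e1
  have : (2 * z) * (jost a V z (-a - t) - Complex.exp (-(z * t))) = 0 := by linear_combination e1
  rcases mul_eq_zero.1 this with h | h
  · exact absurd h (by simpa using hz)
  · exact sub_eq_zero.1 h

lemma IsPotential.jost_right_add (hV : IsPotential a V) {t : ℝ} (ht : 0 ≤ t) :
    jostDeriv a V z (a + t) + z * jost a V z (a + t) = jostFun a V z * Complex.exp (z * t) := by
  have := (hV.isJost z).isSol.right_tail (a := a) (z := -z) (fun x hx => by simp [hV.eq_zero_of_le hx]) ht
  simpa [jostFun] using this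

lemma IsPotential.jost_right (hV : IsPotential a V) (hz : z ≠ 0) {t : ℝ} (ht : 0 ≤ t) :
    jost a V z (a + t) = jostFun a V z / (2 * z) * Complex.exp (z * t) +
      (z * jost a V z a - jostDeriv a V z a) / (2 * z) * Complex.exp (-(z * t)) := by
  have e1 := hV.jost_right_add (z := z) ht
  have e2 := (hV.isJost z).isSol.right_tail (a := a) (z := z) (fun x hx => by simp [hV.eq_zero_of_le hx]) ht
  field_simp
  linear_combination e1 - e2

lemma IsPotential.jost_right_of_jostFun_eq_zero (hV : IsPotential a V) (hz : z ≠ 0)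
    (h0 : jostFun a V z = 0) {t : ℝ} (ht : 0 ≤ t) :
    jost a V z (a + t) = jost a V z a * Complex.exp (-(z * t)) := by
  rw [hV.jost_right hz ht, h0]
  rw [jostFun] at h0
  field_simp
  linear_combination (-Complex.exp (-(z * t))) * h0

/-- Otherwise both Cauchy data at `a` vanish, and so does the whole solution, against its value `1`
at `-a`. -/
lemma IsPotential.jost_ne_zero_of_jostFun_eq_zero (hV : IsPotential a V)
    (h0 : jostFun a V z = 0) : jost a V z a ≠ 0 := by
  intro h
  rw [jostFun, h, mul_zero, add_zero] at h0
  obtain ⟨B, hB⟩ := hV.exists_bound_add (z ^ 2)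
  have hj := hV.isJost z
  have hzero : IsSol (fun x => (V x : ℂ) + z ^ 2) (fun _ => 0) (fun _ => 0) := fun x =>
    ⟨hasDerivAt_const _ _, by simpa using hasDerivAt_const x (0 : ℂ)⟩
  have := congrFun (hj.isSol.unique hB hzero h h0).1 (-a)
  simp [hj.left] at this

end Jost
open FermiGoldenRule

/-! ### Outgoing solutions and distorted plane waves -/

/-- To the right of `a` the radiation defect only rotates by a phase, so its modulus is constant and
a zero limit forces it to vanish at `a`. -/
lemma IsSol.outgoing_right {q u v : ℝ → ℂ} (h : IsSol q u v) {a k : ℝ}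
    (hq : ∀ x, a ≤ x → q x = (Complex.I * k) ^ 2)
    (hlim : Tendsto (fun x => v x - Complex.I * k * u x) atTop (𝓝 0)) :
    v a = Complex.I * k * u a := by
  have h1 : Tendsto (fun t : ℝ => ‖v (a + t) - Complex.I * k * u (a + t)‖) atTop (𝓝 0) := by
    simpa using (hlim.comp (tendsto_atTop_add_const_left atTop a tendsto_id)).norm
  have h2 : (fun t : ℝ => ‖v (a + t) - Complex.I * k * u (a + t)‖) =ᶠ[atTop]
      fun _ => ‖v a - Complex.I * k * u a‖ := by
    filter_upwards [eventually_ge_atTop 0] with t ht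
    rw [h.right_tail hq ht, norm_mul, Complex.norm_exp]
    simp
  have h3 := tendsto_nhds_unique (h1.congr' h2) tendsto_const_nhds
  exact sub_eq_zero.1 (norm_eq_zero.1 h3.symm)

lemma IsSol.outgoing_left {q u v : ℝ → ℂ} (h : IsSol q u v) {a k : ℝ}
    (hq : ∀ x, x ≤ -a → q x = (Complex.I * k) ^ 2)
    (hlim : Tendsto (fun x => v x + Complex.I * k * u x) atBot (𝓝 0)) :
    v (-a) = -(Complex.I * k * u (-a)) := by
  have h1 := h.comp_neg.outgoing_right (a := a) (k := k) (fun x hx => hq _ (by linarith)) (by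
    have := (hlim.comp tendsto_neg_atTop_atBot).neg
    rw [neg_zero] at this
    refine this.congr fun x => ?_
    simp only [Function.comp_apply]
    ring)
  linear_combination -h1

/-- Since `V` is real, the flux `v ū - u v̄` is constant. It equals `2ik|u(a)|²` at `a` and
`-2ik|u(-a)|²` at `-a`, so both boundary values vanish. -/
lemma IsPotential.eq_zero_of_outgoing {a : ℝ} {V : ℝ → ℝ} (hV : IsPotential a V) {k : ℝ}
    (hk : k ≠ 0) {u v : ℝ → ℂ} (h : IsSol (fun x => (V x : ℂ) + (Complex.I * k) ^ 2) u v)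
    (hr : v a = Complex.I * k * u a) (hl : v (-a) = -(Complex.I * k * u (-a))) (x : ℝ) :
    u x = 0 ∧ v x = 0 := by
  have hc := h.conj
  simp only [map_add, map_pow, map_mul, Complex.conj_I, Complex.conj_ofReal] at hc
  have hW : ∀ x, HasDerivAt (fun x => v x * conj (u x) - u x * conj (v x)) 0 x := fun x =>
    (h.wronskian_eq hc x).congr_deriv (by ring)
  have hconst := is_const_of_deriv_eq_zero (fun x => (hW x).differentiableAt)
    (fun x => (hW x).deriv) a (-a)
  simp only [hr, hl, map_mul, map_neg, Complex.conj_I, Complex.conj_ofReal] at hconst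
  have hI : 2 * Complex.I * k * ((‖u a‖ ^ 2 + ‖u (-a)‖ ^ 2 : ℝ) : ℂ) = 0 := by
    push_cast
    rw [← Complex.mul_conj', ← Complex.mul_conj']
    linear_combination hconst
  have hne : (2 * Complex.I * k : ℂ) ≠ 0 := by simp [hk]
  have h0 : ‖u a‖ ^ 2 + ‖u (-a)‖ ^ 2 = 0 := by
    exact_mod_cast (mul_eq_zero.1 hI).resolve_left hne
  have hua : u a = 0 := by
    have : ‖u a‖ ^ 2 = 0 := by nlinarith [sq_nonneg ‖u a‖, sq_nonneg ‖u (-a)‖]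
    simpa using this
  obtain ⟨B, hB⟩ := hV.exists_bound_add ((Complex.I * k) ^ 2)
  have hzero : IsSol (fun x => (V x : ℂ) + (Complex.I * k) ^ 2) (fun _ => 0) (fun _ => 0) :=
    fun x => ⟨hasDerivAt_const _ _, by simpa using hasDerivAt_const x (0 : ℂ)⟩
  have := h.unique hB hzero (x₀ := a) hua (by simp [hr, hua])
  exact ⟨congrFun this.1 x, congrFun this.2 x⟩

lemma solvesSchrodinger_iff_isSol {V : ℝ → ℝ} {E : ℝ} {z : ℂ} (hz : z ^ 2 = -(E : ℂ)) {u : ℝ → ℂ} :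
    SolvesSchrodinger V E 0 u ↔ IsSol (fun x => (V x : ℂ) + z ^ 2) u (deriv u) := by
  constructor
  · rintro ⟨h1, h2⟩ x
    refine ⟨(h1 x).hasDerivAt, (h2 x).congr_deriv ?_⟩
    rw [hz]
    simp [sub_eq_add_neg]
  · intro h
    refine ⟨fun x => (h x).1.differentiableAt, fun x => (h x).2.congr_deriv ?_⟩
    rw [hz]
    simp [sub_eq_add_neg]

/-- The difference of two outgoing solutions is a homogeneous outgoing solution, hence zero; any
explicit candidate thus identifies the resolvent. -/
lemma IsPotential.outgoingResolvent_eq {a : ℝ} {V : ℝ → ℝ} (hV : IsPotential a V) {k : ℝ}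
    (hk : k ≠ 0) {f φ : ℝ → ℂ} (h : SolvesSchrodinger V (k ^ 2) f φ) (ho : IsOutgoing k φ) :
    outgoingResolvent V k f = φ := by
  obtain ⟨h', ho'⟩ := Classical.epsilon_spec (p := fun φ : ℝ → ℂ =>
    SolvesSchrodinger V (k ^ 2) f φ ∧ IsOutgoing k φ) ⟨φ, h, ho⟩
  change SolvesSchrodinger V (k ^ 2) f (outgoingResolvent V k f) at h'
  change IsOutgoing k (outgoingResolvent V k f) at ho'
  set χ := outgoingResolvent V k f
  have hI : (Complex.I * k) ^ 2 = -(((k ^ 2 : ℝ)) : ℂ) := by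
    rw [mul_pow, Complex.I_sq]; push_cast; ring
  have hs : IsSol (fun x => (V x : ℂ) + (Complex.I * k) ^ 2) (fun x => χ x - φ x)
      (fun x => deriv χ x - deriv φ x) := fun x => by
    refine ⟨(h'.1 x).hasDerivAt.sub (h.1 x).hasDerivAt, ((h'.2 x).sub (h.2 x)).congr_deriv ?_⟩
    change ((V x - k ^ 2 : ℝ) : ℂ) * χ x - f x - (((V x - k ^ 2 : ℝ) : ℂ) * φ x - f x) = _
    rw [hI]
    push_cast
    ring
  funext x
  refine sub_eq_zero.1 (hV.eq_zero_of_outgoing hk hs (hs.outgoing_right ?_ ?_)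
    (hs.outgoing_left ?_ ?_) x).1
  · exact fun x hx => by simp [hV.eq_zero_of_le hx]
  · simpa using (ho'.1.sub ho.1).congr fun x => by ring
  · exact fun x hx => by simp [hV.eq_zero_of_le_neg hx]
  · simpa using (ho'.2.sub ho.2).congr fun x => by ring

lemma FermiGoldenRule.SolvesSchrodinger.comp_neg {V : ℝ → ℝ} {E : ℝ} {f u : ℝ → ℂ}
    (h : SolvesSchrodinger V E f u) :
    SolvesSchrodinger (fun x => V (-x)) E (fun x => f (-x)) (fun x => u (-x)) := by
  have hd : deriv (fun x => u (-x)) = fun x => -deriv u (-x) := funext fun x => deriv_comp_neg u x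
  refine ⟨h.1.comp differentiable_neg, fun x => ?_⟩
  rw [hd]
  exact ((h.2 (-x)).scomp x (hasDerivAt_neg x)).neg.congr_deriv (by simp)

lemma FermiGoldenRule.IsOutgoing.comp_neg {k : ℝ} {φ : ℝ → ℂ} (h : IsOutgoing k φ) :
    IsOutgoing k (fun x => φ (-x)) := by
  have hd : deriv (fun x => φ (-x)) = fun x => -deriv φ (-x) := funext fun x => deriv_comp_neg φ x
  rw [IsOutgoing, hd]
  constructor
  · simpa using (h.2.comp tendsto_neg_atTop_atBot).neg.congr fun x => by
      simp only [Function.comp_apply]; ring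
  · simpa using (h.1.comp tendsto_neg_atBot_atTop).neg.congr fun x => by
      simp only [Function.comp_apply]; ring

/-- At `z = -ik` the Jost solution is outgoing on the left by construction, and a zero of the Jost
function would make it outgoing on the right as well. -/
lemma IsPotential.jostFun_ne_zero {a : ℝ} {V : ℝ → ℝ} (hV : IsPotential a V) {k : ℝ}
    (hk : k ≠ 0) : jostFun a V (-(Complex.I * k)) ≠ 0 := by
  intro h0
  have hj := hV.isJost (-(Complex.I * k))
  have hs := hj.isSol
  rw [neg_sq] at hs
  have := (hV.eq_zero_of_outgoing hk hs (by rw [jostFun] at h0; linear_combination h0)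
    (by rw [hj.left, hj.left_deriv, mul_one]) (-a)).1
  rw [hj.left] at this
  exact one_ne_zero this

/-- The normalization of the distorted plane wave relative to the Jost solution. -/
noncomputable def waveCoeff (a : ℝ) (V : ℝ → ℝ) (z : ℂ) : ℂ :=
  2 * z * Complex.exp (z * a) / jostFun a V z

lemma hasDerivAt_planeWave (σ k x : ℝ) :
    HasDerivAt (planeWave σ k) (Complex.I * (σ * k) * planeWave σ k x) x := by
  have h1 : HasDerivAt (fun x : ℝ => Complex.I * ((σ * k * x : ℝ) : ℂ))
      (Complex.I * ((σ * k * 1 : ℝ) : ℂ)) x :=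
    (((hasDerivAt_id x).const_mul (σ * k)).ofReal_comp).const_mul _
  refine h1.cexp.congr_deriv ?_
  simp only [planeWave, mul_one]
  push_cast
  ring

/-- On the left both terms are multiples of `exp (-ikx)`, which is outgoing there. On the right
`waveCoeff` is exactly the factor that cancels the incoming `exp (-ikx)` component. -/
lemma IsPotential.outgoing_correction {a : ℝ} {V : ℝ → ℝ} (hV : IsPotential a V) {k : ℝ}
    (hk : k ≠ 0) :
    SolvesSchrodinger V (k ^ 2) (fun y => (V y : ℂ) * planeWave (-1) k y)
        (fun x => planeWave (-1) k x -
          waveCoeff a V (-(Complex.I * k)) * jost a V (-(Complex.I * k)) x) ∧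
      IsOutgoing k (fun x => planeWave (-1) k x -
          waveCoeff a V (-(Complex.I * k)) * jost a V (-(Complex.I * k)) x) := by
  set z : ℂ := -(Complex.I * k) with hz
  have hz0 : z ≠ 0 := by simp [hz, hk]
  have hz2 : z ^ 2 = -(k : ℂ) ^ 2 := by rw [hz, neg_sq, mul_pow, Complex.I_sq]; ring
  set c := waveCoeff a V z with hc
  have hj := hV.isJost z
  have hp : ∀ x, HasDerivAt (planeWave (-1) k) (z * planeWave (-1) k x) x := fun x =>
    (hasDerivAt_planeWave (-1) k x).congr_deriv (by rw [hz]; push_cast; ring)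
  have hd1 : ∀ x, HasDerivAt (fun x => planeWave (-1) k x - c * jost a V z x)
      (z * planeWave (-1) k x - c * jostDeriv a V z x) x := fun x =>
    (hp x).sub ((hj.isSol x).1.const_mul c)
  have hder : deriv (fun x => planeWave (-1) k x - c * jost a V z x) =
      fun x => z * planeWave (-1) k x - c * jostDeriv a V z x := funext fun x => (hd1 x).deriv
  have hplane : ∀ x, planeWave (-1) k x = Complex.exp (z * x) := fun x => by
    rw [planeWave, hz]; congr 1; push_cast; ring
  refine ⟨⟨fun x => (hd1 x).differentiableAt, fun x => ?_⟩, ?_, ?_⟩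
  · rw [hder]
    refine (((hp x).const_mul z).sub ((hj.isSol x).2.const_mul c)).congr_deriv ?_
    push_cast
    linear_combination (planeWave (-1) k x - c * jost a V z x) * hz2
  · rw [hder]
    refine tendsto_const_nhds.congr' ?_
    filter_upwards [eventually_ge_atTop a] with x hx
    have h1 := hV.jost_right_add (z := z) (sub_nonneg.2 hx)
    rw [add_sub_cancel] at h1
    have h2 : c * jostFun a V z = 2 * z * Complex.exp (z * a) := by
      rw [hc, waveCoeff, div_mul_cancel₀ _ (hV.jostFun_ne_zero hk)]
    have h3 : Complex.exp (z * x) = Complex.exp (z * a) * Complex.exp (z * (x - a : ℝ)) := by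
      rw [← Complex.exp_add]; congr 1; push_cast; ring
    have hIk : Complex.I * k = -z := by rw [hz, neg_neg]
    rw [hplane, hIk, h3]
    linear_combination c * h1 + Complex.exp (z * (x - a : ℝ)) * h2
  · rw [hder]
    refine tendsto_const_nhds.congr' ?_
    filter_upwards [eventually_le_atBot (-a)] with x hx
    have h1 := (hV.jost_left hz0 (t := -a - x) (by linarith)).2
    rw [sub_sub_cancel] at h1
    have hIk : Complex.I * k = -z := by rw [hz, neg_neg]
    rw [hIk, h1]
    ring

lemma IsPotential.distortedPlaneWave_neg_one {a : ℝ} {V : ℝ → ℝ} (hV : IsPotential a V) {k : ℝ}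
    (hk : k ≠ 0) (x : ℝ) : distortedPlaneWave V (-1) k x =
      waveCoeff a V (-(Complex.I * k)) * jost a V (-(Complex.I * k)) x := by
  obtain ⟨h, ho⟩ := hV.outgoing_correction hk
  rw [distortedPlaneWave, hV.outgoingResolvent_eq hk h ho]
  ring

lemma planeWave_neg (k x : ℝ) : planeWave (-1) k (-x) = planeWave 1 k x := by
  simp [planeWave]

lemma IsPotential.distortedPlaneWave_one {a : ℝ} {V : ℝ → ℝ} (hV : IsPotential a V) {k : ℝ}
    (hk : k ≠ 0) (x : ℝ) :
    distortedPlaneWave V 1 k x = distortedPlaneWave (fun x => V (-x)) (-1) k (-x) := by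
  obtain ⟨h, ho⟩ := hV.comp_neg.outgoing_correction hk
  have h' := h.comp_neg
  simp only [neg_neg, planeWave_neg] at h'
  have ho' := ho.comp_neg
  simp only [planeWave_neg] at ho'
  rw [distortedPlaneWave, hV.outgoingResolvent_eq hk h' ho',
    hV.comp_neg.distortedPlaneWave_neg_one hk]
  ring

/-! ### Integrals of functions with exponential tails -/

/-- `h` is continuous, equal to `exp (-ξ (|x| - a))` for `x ≤ -a` and to the combination
`A exp (-η (x - a)) + B exp (-ζ (x - a))` for `a ≤ x`, with decaying exponentials. -/
structure HasExpTails (a : ℝ) (h : ℝ → ℂ) (ξ A η B ζ : ℂ) : Prop where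
  continuous : Continuous h
  left : ∀ x, a ≤ x → h (-x) = Complex.exp (-(ξ * (x - a : ℝ)))
  right : ∀ x, a ≤ x →
    h x = A * Complex.exp (-(η * (x - a : ℝ))) + B * Complex.exp (-(ζ * (x - a : ℝ)))
  re_left : 0 < ξ.re
  re_right : 0 < η.re
  re_right' : 0 < ζ.re

lemma integrableOn_exp_tail (a : ℝ) {ξ : ℂ} (hξ : 0 < ξ.re) :
    IntegrableOn (fun x : ℝ => Complex.exp (-(ξ * (x - a : ℝ)))) (Set.Ioi a) := by
  have h := (integrableOn_exp_mul_complex_Ioi (a := -ξ) (by simpa using hξ) a).const_mul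
    (Complex.exp (ξ * a))
  refine h.congr (Eventually.of_forall fun x => ?_)
  dsimp only
  rw [← Complex.exp_add]
  congr 1
  push_cast
  ring

lemma integrableOn_exp_tail_neg (a : ℝ) {ξ : ℂ} (hξ : 0 < ξ.re) :
    IntegrableOn (fun x : ℝ => Complex.exp (-(ξ * (-x - a : ℝ)))) (Set.Iic (-a)) := by
  have h := (integrableOn_exp_mul_complex_Iic (a := ξ) hξ (-a)).const_mul
    (Complex.exp (ξ * a))
  refine h.congr (Eventually.of_forall fun x => ?_)
  dsimp only
  rw [← Complex.exp_add]
  congr 1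
  push_cast
  ring

section ExpTails

variable {a : ℝ} {h : ℝ → ℂ} {ξ A η B ζ : ℂ}

lemma HasExpTails.integrable (H : HasExpTails a h ξ A η B ζ) : Integrable h := by
  have h1 : IntegrableOn h (Set.Iic (-a)) := by
    refine (integrableOn_exp_tail_neg a H.re_left).congr_fun (fun x hx => ?_) measurableSet_Iic
    have := H.left (-x) (by linarith [Set.mem_Iic.1 hx])
    rw [neg_neg] at this
    exact this.symm
  have h2 : IntegrableOn h (Set.Ioi a) := by
    have : IntegrableOn (fun x : ℝ => A * Complex.exp (-(η * (x - a : ℝ))) +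
        B * Complex.exp (-(ζ * (x - a : ℝ)))) (Set.Ioi a) :=
      ((integrableOn_exp_tail a H.re_right).const_mul A).add
        ((integrableOn_exp_tail a H.re_right').const_mul B)
    exact this.congr_fun (fun x hx => (H.right x (le_of_lt hx)).symm) measurableSet_Ioi
  have h3 : IntegrableOn h (Set.Icc (-a) a) := H.continuous.continuousOn.integrableOn_Icc
  have h4 : IntegrableOn h Set.univ := ((h1.union h2).union h3).mono_set fun x _ => by
    rcases le_or_gt x (-a) with hx | hx
    · exact Or.inl (Or.inl hx)
    · rcases le_or_gt x a with hx' | hx'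
      · exact Or.inr ⟨hx.le, hx'⟩
      · exact Or.inl (Or.inr hx')
  rwa [integrableOn_univ] at h4

/-- The one-sided Laplace transform based at `a`. -/
noncomputable def laplaceFrom (a : ℝ) (β : ℝ → ℂ) (z : ℂ) : ℂ :=
  ∫ x in Set.Ioi a, β x * Complex.exp (-(z * (x - a : ℝ)))

/-- Separates the non-compact part of the integral: the tails enter only through their exponents and
amplitudes, and the rest lives on `(-a, a]`. -/
lemma HasExpTails.integral_mul (ha : 0 ≤ a) (H : HasExpTails a h ξ A η B ζ) {β : ℝ → ℂ}
    (hβ : MemLp β ⊤) :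
    ∫ x, β x * h x = laplaceFrom a (fun x => β (-x)) ξ + (∫ x in Set.Ioc (-a) a, β x * h x) +
      (A * laplaceFrom a β η + B * laplaceFrom a β ζ) := by
  have hi : Integrable fun x => β x * h x := H.integrable.mul_of_top_right hβ
  have e1 : ∫ x in Set.Iic (-a), β x * h x = laplaceFrom a (fun x => β (-x)) ξ := by
    rw [← integral_comp_neg_Ioi, laplaceFrom]
    refine setIntegral_congr_fun measurableSet_Ioi fun x hx => ?_
    rw [H.left x (le_of_lt hx)]
  have e2 : ∫ x in Set.Ioi a, β x * h x = A * laplaceFrom a β η + B * laplaceFrom a β ζ := by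
    rw [laplaceFrom, laplaceFrom, ← integral_const_mul, ← integral_const_mul, ← integral_add]
    · refine setIntegral_congr_fun measurableSet_Ioi fun x hx => ?_
      rw [H.right x (le_of_lt hx)]
      ring
    · exact (Integrable.mul_of_top_right (integrableOn_exp_tail a H.re_right)
        (hβ.restrict _)).const_mul A
    · exact (Integrable.mul_of_top_right (integrableOn_exp_tail a H.re_right')
        (hβ.restrict _)).const_mul B
  have e3 : ∫ x in Set.Iic a, β x * h x =
      (∫ x in Set.Iic (-a), β x * h x) + ∫ x in Set.Ioc (-a) a, β x * h x := by
    rw [← setIntegral_union (Set.Iic_disjoint_Ioc le_rfl) measurableSet_Ioc hi.integrableOn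
      hi.integrableOn, Set.Iic_union_Ioc_eq_Iic (by linarith)]
  rw [← intervalIntegral.integral_Iic_add_Ioi hi.integrableOn hi.integrableOn (b := a), e3, e1, e2]

lemma exists_ae_bound_of_memLp_top {β : ℝ → ℂ} (hβ : MemLp β ⊤) :
    ∃ b, 0 ≤ b ∧ ∀ᵐ x, ‖β x‖ ≤ b := by
  have h1 := hβ.2
  rw [eLpNorm_exponent_top] at h1
  refine ⟨(eLpNormEssSup β volume).toReal, ENNReal.toReal_nonneg, ?_⟩
  filter_upwards [ae_le_eLpNormEssSup (f := β) (μ := volume)] with x hx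
  rw [← toReal_enorm]
  exact ENNReal.toReal_mono h1.ne hx

/-- Differentiation under the integral sign, dominated on the half-plane `re w > re z / 2`. -/
lemma differentiableAt_laplaceFrom (a : ℝ) {β : ℝ → ℂ} (hβ : MemLp β ⊤) {z : ℂ} (hz : 0 < z.re) :
    DifferentiableAt ℂ (laplaceFrom a β) z := by
  obtain ⟨b, hb0, hb⟩ := exists_ae_bound_of_memLp_top hβ
  set c := z.re / 2 with hc
  have hc0 : 0 < c := by positivity
  have hs : {w : ℂ | c < w.re} ∈ 𝓝 z :=
    (isOpen_lt continuous_const Complex.continuous_re).mem_nhds (by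
      change c < z.re
      linarith)
  have hm : AEStronglyMeasurable β (volume.restrict (Set.Ioi a)) := (hβ.restrict _).1
  have hcont : ∀ w : ℂ, Continuous fun x : ℝ => Complex.exp (-(w * (x - a : ℝ))) := fun w => by
    fun_prop
  refine (hasDerivAt_integral_of_dominated_loc_of_deriv_le hs
    (F' := fun w x => β x * (Complex.exp (-(w * (x - a : ℝ))) * -((x - a : ℝ) : ℂ)))
    (bound := fun x => b * (2 / c) * Real.exp (-(c / 2) * (x - a)))
    (Eventually.of_forall fun w => hm.mul (hcont w).aestronglyMeasurable)
    (Integrable.mul_of_top_right (integrableOn_exp_tail a hz) (hβ.restrict _))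
    (hm.mul (Continuous.aestronglyMeasurable (by fun_prop))) ?_ ?_ ?_).2.differentiableAt
  · filter_upwards [ae_restrict_of_ae hb, ae_restrict_mem measurableSet_Ioi] with x hx hxa w hw
    have hx0 : 0 ≤ x - a := by linarith [Set.mem_Ioi.1 hxa]
    rw [norm_mul, norm_mul, norm_neg, Complex.norm_real, Real.norm_of_nonneg hx0, Complex.norm_exp]
    have e1 : (-(w * (x - a : ℝ))).re = -(w.re * (x - a)) := by
      rw [Complex.neg_re, Complex.re_mul_ofReal]
    have e2 : Real.exp (-(w.re * (x - a))) ≤ Real.exp (-(c / 2) * (x - a)) *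
        Real.exp (-(c / 2) * (x - a)) := by
      rw [← Real.exp_add]
      refine Real.exp_le_exp.2 ?_
      have : c * (x - a) ≤ w.re * (x - a) := mul_le_mul_of_nonneg_right (le_of_lt hw) hx0
      linarith
    -- Half of the exponential decay absorbs the factor `x - a` produced by differentiation, via `1
    -- + s ≤ exp s`; the other half stays integrable.
    have e3 : Real.exp (-(c / 2) * (x - a)) * (x - a) ≤ 2 / c := by
      have h1 := Real.add_one_le_exp (c / 2 * (x - a))
      rw [neg_mul, Real.exp_neg, inv_mul_le_iff₀ (Real.exp_pos _)]
      have h2 : x - a = (c / 2 * (x - a)) * (2 / c) := by field_simp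
      calc x - a = (c / 2 * (x - a)) * (2 / c) := h2
        _ ≤ _ := mul_le_mul_of_nonneg_right (by linarith) (by positivity)
    rw [e1, mul_assoc]
    refine mul_le_mul hx ?_ (by positivity) hb0
    calc _ ≤ Real.exp (-(c / 2) * (x - a)) * Real.exp (-(c / 2) * (x - a)) * (x - a) :=
          mul_le_mul_of_nonneg_right e2 hx0
      _ = (Real.exp (-(c / 2) * (x - a)) * (x - a)) * Real.exp (-(c / 2) * (x - a)) := by ring
      _ ≤ _ := mul_le_mul_of_nonneg_right e3 (Real.exp_nonneg _)
  · have h1 := (exp_neg_integrableOn_Ioi a (b := c / 2) (by positivity)).const_mul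
      (b * (2 / c) * Real.exp (c / 2 * a))
    refine Integrable.congr h1 (Eventually.of_forall fun x => ?_)
    dsimp only
    rw [mul_assoc, ← Real.exp_add]
    congr 2
    ring
  · refine Eventually.of_forall fun x w _ => ?_
    have h1 : HasDerivAt (fun w : ℂ => -(w * (x - a : ℝ))) (-((x - a : ℝ) : ℂ)) w :=
      ((hasDerivAt_id w).mul_const ((x - a : ℝ) : ℂ)).neg.congr_deriv (by rw [one_mul])
    exact h1.cexp.const_mul _

end ExpTails

/-! ### Bound states and Jost solutions -/

lemma IsPotential.jost_neg {a : ℝ} {V : ℝ → ℝ} (hV : IsPotential a V) {z : ℂ} (hz : z ≠ 0) {x : ℝ}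
    (hx : a ≤ x) : jost a V z (-x) = Complex.exp (-(z * (x - a : ℝ))) := by
  rw [← (hV.jost_left hz (sub_nonneg.2 hx)).1]
  congr 1
  ring

/-- Meant for a bound state factor `z = κ` and a wave factor `w = -ik`: on the right the former is a
pure decaying exponential and the latter mixes `exp (±w x)`. -/
lemma IsPotential.hasExpTails_mul {a : ℝ} {V : ℝ → ℝ} (hV : IsPotential a V) {z w : ℂ}
    (h0 : jostFun a V z = 0) (hw : w ≠ 0) (hz : 0 < z.re) (h1 : 0 < (z + w).re)
    (h2 : 0 < (z - w).re) :
    HasExpTails a (fun x => jost a V z x * jost a V w x) (z + w)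
      (jost a V z a * (jostFun a V w / (2 * w))) (z - w)
      (jost a V z a * ((w * jost a V w a - jostDeriv a V w a) / (2 * w))) (z + w) := by
  have hz0 : z ≠ 0 := by rintro rfl; simp at hz
  refine ⟨(hV.isJost z).isSol.continuous.mul (hV.isJost w).isSol.continuous, fun x hx => ?_,
    fun x hx => ?_, h1, h2, h1⟩
  · rw [hV.jost_neg hz0 hx, hV.jost_neg hw hx, ← Complex.exp_add]
    congr 1
    ring
  · have e1 := hV.jost_right_of_jostFun_eq_zero hz0 h0 (sub_nonneg.2 hx)
    have e2 := hV.jost_right hw (sub_nonneg.2 hx)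
    rw [add_sub_cancel] at e1 e2
    have e3 : Complex.exp (-((z - w) * (x - a : ℝ))) =
        Complex.exp (-(z * (x - a : ℝ))) * Complex.exp (w * (x - a : ℝ)) := by
      rw [← Complex.exp_add]; congr 1; ring
    have e4 : Complex.exp (-((z + w) * (x - a : ℝ))) =
        Complex.exp (-(z * (x - a : ℝ))) * Complex.exp (-(w * (x - a : ℝ))) := by
      rw [← Complex.exp_add]; congr 1; ring
    rw [e1, e2, e3, e4]
    ring

/-- The product lemma does not cover `w = z`, as `z - w` would not have positive real part. Here the
growing component is absent, so one right exponential suffices; the second has amplitude `0` and a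
placeholder exponent. -/
lemma IsPotential.hasExpTails_sq {a : ℝ} {V : ℝ → ℝ} (hV : IsPotential a V) {z : ℂ}
    (h0 : jostFun a V z = 0) (hz : 0 < z.re) :
    HasExpTails a (fun x => jost a V z x * jost a V z x) (2 * z)
      (jost a V z a * jost a V z a) (2 * z) 0 (2 * z) := by
  have hz0 : z ≠ 0 := by rintro rfl; simp at hz
  have hz2 : 0 < (2 * z).re := by simpa using hz
  refine ⟨(hV.isJost z).isSol.continuous.mul (hV.isJost z).isSol.continuous, fun x hx => ?_,
    fun x hx => ?_, hz2, hz2, hz2⟩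
  · rw [hV.jost_neg hz0 hx, ← Complex.exp_add]
    congr 1
    ring
  · have e1 := hV.jost_right_of_jostFun_eq_zero hz0 h0 (sub_nonneg.2 hx)
    rw [add_sub_cancel] at e1
    rw [e1, zero_mul, add_zero, mul_mul_mul_comm, ← Complex.exp_add]
    congr 2
    ring

section BoundState

variable {a : ℝ} {V : ℝ → ℝ} {κ : ℝ}

lemma IsPotential.jost_mul_self (hV : IsPotential a V) (x : ℝ) :
    jost a V κ x * jost a V κ x = ((‖jost a V κ x‖ ^ 2 : ℝ) : ℂ) := by
  have := (hV.conj_jost (Complex.conj_ofReal κ) x).1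
  push_cast
  rw [← Complex.mul_conj', this]

lemma IsPotential.memLp_jost (hV : IsPotential a V) (hκ : 0 < κ) (h0 : jostFun a V κ = 0) :
    MemLp (jost a V κ) 2 := by
  have hc := (hV.isJost κ).isSol.continuous
  rw [memLp_two_iff_integrable_sq_norm hc.aestronglyMeasurable]
  have h1 := (hV.hasExpTails_sq h0 (by simpa using hκ)).integrable.norm
  refine h1.congr (Eventually.of_forall fun x => ?_)
  simp [sq]

lemma eLpNorm_two_eq_one_iff {f : ℝ → ℂ} (hf : MemLp f 2) :
    eLpNorm f 2 volume = 1 ↔ ∫ x, ‖f x‖ ^ 2 = 1 := by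
  rw [hf.eLpNorm_eq_integral_rpow_norm (by norm_num) (by norm_num), ENNReal.ofReal_eq_one]
  simp only [ENNReal.toReal_ofNat, Real.rpow_ofNat]
  have h0 : 0 ≤ ∫ x, ‖f x‖ ^ 2 := integral_nonneg fun x => by positivity
  rw [Real.rpow_inv_eq h0 zero_le_one (by norm_num), Real.one_rpow]

lemma IsPotential.integral_norm_sq_pos (hV : IsPotential a V) (hκ : 0 < κ)
    (h0 : jostFun a V κ = 0) : 0 < ∫ x, ‖jost a V κ x‖ ^ 2 := by
  have hj := hV.isJost κ
  have hc := hj.isSol.continuous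
  have hi := (memLp_two_iff_integrable_sq_norm hc.aestronglyMeasurable).1 (hV.memLp_jost hκ h0)
  refine integral_pos_of_integrable_nonneg_nonzero (x := -a) (hc.norm.pow 2) hi
    (fun x => by positivity) ?_
  simp [hj.left]

lemma IsPotential.isEigenvalue (hV : IsPotential a V) (hκ : 0 < κ) (h0 : jostFun a V κ = 0) :
    IsEigenvalue V (-κ ^ 2) := by
  have hj := hV.isJost κ
  have hN := hV.integral_norm_sq_pos hκ h0
  set N := ∫ x, ‖jost a V κ x‖ ^ 2
  have hm : MemLp (fun x => ((Real.sqrt N)⁻¹ : ℂ) * jost a V κ x) 2 :=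
    (hV.memLp_jost hκ h0).const_mul _
  refine ⟨fun x => ((Real.sqrt N)⁻¹ : ℂ) * jost a V κ x, ?_, hm, ?_⟩
  · have hs := hj.isSol.const_mul ((Real.sqrt N)⁻¹ : ℂ)
    rw [solvesSchrodinger_iff_isSol (z := κ) (by push_cast; ring), hs.deriv_eq]
    exact hs
  · rw [eLpNorm_two_eq_one_iff hm]
    simp only [norm_mul, mul_pow]
    rw [integral_const_mul, norm_inv, Complex.norm_real, Real.norm_of_nonneg (Real.sqrt_nonneg _),
      inv_pow, Real.sq_sqrt hN.le]
    exact inv_mul_cancel₀ hN.ne'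

/-- Square integrability removes the growing exponential at both ends: on the left this forces
proportionality to the Jost solution, on the right the vanishing of the Jost function. -/
lemma IsPotential.eq_mul_jost_of_eigenfunction (hV : IsPotential a V) (hκ : 0 < κ) {ψ : ℝ → ℂ}
    (hψ : IsNormalizedEigenfunction V (-κ ^ 2) ψ) :
    jostFun a V κ = 0 ∧ ∃ c : ℂ, (∀ x, ψ x = c * jost a V κ x) ∧
      ‖c‖ ^ 2 * ∫ x, ‖jost a V κ x‖ ^ 2 = 1 := by
  obtain ⟨hs, hm, hn⟩ := hψ
  rw [solvesSchrodinger_iff_isSol (z := κ) (by push_cast; ring)] at hs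
  have hr := hs.decaying_of_memLp (a := a) hκ (fun x hx => by simp [hV.eq_zero_of_le hx]) hm
  have hmn : MemLp (fun x => ψ (-x)) 2 := hm.comp_measurePreserving (Measure.measurePreserving_neg _)
  have hl := hs.comp_neg.decaying_of_memLp (a := a) hκ
    (fun x hx => by simp [hV.eq_zero_of_le_neg (neg_le_neg hx)]) hmn
  obtain ⟨h1, h2⟩ := hV.eq_mul_jost hs (by linear_combination -hl)
  rw [eLpNorm_two_eq_one_iff hm] at hn
  have hnn : ‖ψ (-a)‖ ^ 2 * ∫ x, ‖jost a V κ x‖ ^ 2 = 1 := by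
    rw [← hn, ← integral_const_mul]
    refine integral_congr_ae (Eventually.of_forall fun x => ?_)
    dsimp only
    rw [congrFun h1 x, norm_mul, mul_pow]
  refine ⟨?_, ψ (-a), congrFun h1, hnn⟩
  have hne : ψ (-a) ≠ 0 := by
    intro h
    rw [h] at hnn
    simp at hnn
  rw [congrFun h1 a, congrFun h2 a] at hr
  refine (mul_eq_zero.1 (?_ : ψ (-a) * jostFun a V κ = 0)).resolve_left hne
  rw [jostFun]
  linear_combination hr

end BoundState

/-! ### Algebra of Lipschitz estimates -/

section Lipschitz

open Asymptotics

variable {ι : Type*} {l : Filter ι} {d : ι → ℝ}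

/-- The reference values may vary with the index, so that the estimate also applies uniformly in
`x`, with `x` part of the index. -/
lemma lip_mul {𝕜 : Type*} [RCLike 𝕜] {f g f₀ g₀ : ι → 𝕜} (hd : d =O[l] fun _ => (1 : ℝ))
    (hf : (fun i => f i - f₀ i) =O[l] d) (hg : (fun i => g i - g₀ i) =O[l] d)
    (hf₀ : f₀ =O[l] fun _ => (1 : ℝ)) (hg₀ : g₀ =O[l] fun _ => (1 : ℝ)) :
    (fun i => f i * g i - f₀ i * g₀ i) =O[l] d := by
  have h1 := hf.mul (hg.trans hd)
  have h2 := hf.mul hg₀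
  have h3 := hf₀.mul hg
  simp only [mul_one, one_mul] at h1 h2 h3
  exact ((h1.add h2).add h3).congr_left fun i => by ring

lemma lip_mul_const {𝕜 : Type*} [RCLike 𝕜] {f g : ι → 𝕜} {f₀ g₀ : 𝕜} (hd : Tendsto d l (𝓝 0))
    (hf : (fun i => f i - f₀) =O[l] d) (hg : (fun i => g i - g₀) =O[l] d) :
    (fun i => f i * g i - f₀ * g₀) =O[l] d :=
  lip_mul (hd.isBigO_one ℝ) hf hg (isBigO_const_const _ one_ne_zero _)
    (isBigO_const_const _ one_ne_zero _)

lemma lip_add {𝕜 : Type*} [RCLike 𝕜] {f g : ι → 𝕜} {f₀ g₀ : 𝕜}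
    (hf : (fun i => f i - f₀) =O[l] d) (hg : (fun i => g i - g₀) =O[l] d) :
    (fun i => f i + g i - (f₀ + g₀)) =O[l] d :=
  (hf.add hg).congr_left fun i => by ring

lemma lip_sub {𝕜 : Type*} [RCLike 𝕜] {f g : ι → 𝕜} {f₀ g₀ : 𝕜}
    (hf : (fun i => f i - f₀) =O[l] d) (hg : (fun i => g i - g₀) =O[l] d) :
    (fun i => f i - g i - (f₀ - g₀)) =O[l] d :=
  (hf.sub hg).congr_left fun i => by ring

lemma lip_const {𝕜 : Type*} [RCLike 𝕜] (c : 𝕜) : (fun _ => c - c) =O[l] d := by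
  simpa using isBigO_zero d l

lemma tendsto_of_lip {𝕜 : Type*} [RCLike 𝕜] {f : ι → 𝕜} {f₀ : 𝕜} (hd : Tendsto d l (𝓝 0))
    (hf : (fun i => f i - f₀) =O[l] d) : Tendsto f l (𝓝 f₀) :=
  tendsto_sub_nhds_zero_iff.1 (hf.trans_tendsto hd)

lemma lip_comp {𝕜 : Type*} [RCLike 𝕜] {f : ι → 𝕜} {f₀ : 𝕜} {Φ : 𝕜 → 𝕜} (hd : Tendsto d l (𝓝 0))
    (hΦ : DifferentiableAt 𝕜 Φ f₀) (hf : (fun i => f i - f₀) =O[l] d) :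
    (fun i => Φ (f i) - Φ f₀) =O[l] d :=
  (hΦ.isBigO_sub.comp_tendsto (tendsto_of_lip hd hf)).trans hf

lemma lip_div {𝕜 : Type*} [RCLike 𝕜] {f g : ι → 𝕜} {f₀ g₀ : 𝕜} (hd : Tendsto d l (𝓝 0))
    (hf : (fun i => f i - f₀) =O[l] d) (hg : (fun i => g i - g₀) =O[l] d) (h0 : g₀ ≠ 0) :
    (fun i => f i / g i - f₀ / g₀) =O[l] d := by
  simp only [div_eq_mul_inv]
  exact lip_mul_const hd hf (lip_comp hd (differentiableAt_inv h0) hg)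

lemma lip_norm_sq {f : ι → ℂ} {f₀ : ℂ} (hd : Tendsto d l (𝓝 0))
    (hf : (fun i => f i - f₀) =O[l] d) : (fun i => ‖f i‖ ^ 2 - ‖f₀‖ ^ 2) =O[l] d := by
  have h : (fun i => ‖f i‖ - ‖f₀‖) =O[l] d :=
    (isBigO_of_le l fun i => by
      rw [Real.norm_eq_abs]; exact abs_norm_sub_norm_le (f i) f₀).trans hf
  simpa only [sq] using lip_mul_const hd h h

lemma lip_ofReal {f : ι → ℝ} {f₀ : ℝ} :
    (fun i => (f i : ℂ) - f₀) =O[l] d ↔ (fun i => f i - f₀) =O[l] d := by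
  rw [← isBigO_norm_left, ← isBigO_norm_left (f' := fun i => f i - f₀)]
  simp only [← Complex.ofReal_sub, Complex.norm_real]

/-- The product with a principal filter encodes uniformity in `x` over the interval. -/
lemma exists_bound_of_isBigO_prod {a b : ℝ} {h : ι → ℝ → ℂ}
    (hO : (fun p : ι × ℝ => h p.1 p.2) =O[l ×ˢ 𝓟 (Set.Icc a b)] fun p => d p.1) :
    ∃ C, 0 ≤ C ∧ ∀ᶠ i in l, ∀ x ∈ Set.Icc a b, ‖h i x‖ ≤ C * |d i| := by
  obtain ⟨C, hC, h⟩ := hO.exists_nonneg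
  exact ⟨C, hC, eventually_prod_principal_iff.1 h.bound⟩

lemma lip_setIntegral {a b : ℝ} {h : ι → ℝ → ℂ} {h₀ : ℝ → ℂ} {β : ℝ → ℂ} (hβ : MemLp β ⊤)
    (hc : ∀ᶠ i in l, Continuous (h i)) (hc₀ : Continuous h₀)
    (hO : (fun p : ι × ℝ => h p.1 p.2 - h₀ p.2) =O[l ×ˢ 𝓟 (Set.Icc a b)] fun p => d p.1) :
    (fun i => (∫ x in Set.Ioc a b, β x * h i x) - ∫ x in Set.Ioc a b, β x * h₀ x) =O[l] d := by
  obtain ⟨B, hB0, hB⟩ := exists_ae_bound_of_memLp_top hβ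
  obtain ⟨C, hC0, hC⟩ := exists_bound_of_isBigO_prod (h := fun i x => h i x - h₀ x) hO
  have hint : ∀ {g : ℝ → ℂ}, Continuous g →
      IntegrableOn (fun x => β x * g x) (Set.Ioc a b) := fun hg =>
    Integrable.mul_of_top_right (hg.continuousOn.integrableOn_Icc.mono_set Set.Ioc_subset_Icc_self)
      (hβ.restrict _)
  refine IsBigO.of_bound (B * C * volume.real (Set.Ioc a b)) ?_
  filter_upwards [hC, hc] with i hi hci
  rw [← integral_sub (hint hci) (hint hc₀)]
  calc _ ≤ (B * (C * |d i|)) * volume.real (Set.Ioc a b) := by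
        refine norm_setIntegral_le_of_norm_le_const_ae' (by simp) ?_
        filter_upwards [hB] with x hx hxm
        rw [← mul_sub, norm_mul]
        exact mul_le_mul hx (hi x (Set.Ioc_subset_Icc_self hxm)) (norm_nonneg _) hB0
    _ = _ := by rw [Real.norm_eq_abs]; ring

/-- Lipschitz dependence of the integral against a bounded function, for a family of functions with
exponential tails. -/
lemma lip_integral {a : ℝ} (ha : 0 ≤ a) {h : ι → ℝ → ℂ} {h₀ : ℝ → ℂ} {ξ A η B ζ : ι → ℂ}
    {ξ₀ A₀ η₀ B₀ ζ₀ : ℂ} {β : ℝ → ℂ} (hβ : MemLp β ⊤) (hd : Tendsto d l (𝓝 0))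
    (H : ∀ᶠ i in l, HasExpTails a (h i) (ξ i) (A i) (η i) (B i) (ζ i))
    (H₀ : HasExpTails a h₀ ξ₀ A₀ η₀ B₀ ζ₀)
    (hO : (fun p : ι × ℝ => h p.1 p.2 - h₀ p.2) =O[l ×ˢ 𝓟 (Set.Icc (-a) a)] fun p => d p.1)
    (hξ : (fun i => ξ i - ξ₀) =O[l] d) (hA : (fun i => A i - A₀) =O[l] d)
    (hη : (fun i => η i - η₀) =O[l] d) (hB : (fun i => B i - B₀) =O[l] d)
    (hζ : (fun i => ζ i - ζ₀) =O[l] d) :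
    (fun i => (∫ x, β x * h i x) - ∫ x, β x * h₀ x) =O[l] d := by
  have hβn : MemLp (fun x => β (-x)) ⊤ :=
    hβ.comp_measurePreserving (Measure.measurePreserving_neg _)
  have h1 := lip_comp hd (differentiableAt_laplaceFrom a hβn H₀.re_left) hξ
  have h2 := lip_comp hd (differentiableAt_laplaceFrom a hβ H₀.re_right) hη
  have h3 := lip_comp hd (differentiableAt_laplaceFrom a hβ H₀.re_right') hζ
  have h4 := lip_setIntegral hβ (H.mono fun i hi => hi.continuous) H₀.continuous hO
  have h5 := lip_add (lip_add h1 h4) (lip_add (lip_mul_const hd hA h2) (lip_mul_const hd hB h3))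
  refine h5.congr' ?_ EventuallyEq.rfl
  filter_upwards [H] with i hi
  rw [hi.integral_mul ha hβ, H₀.integral_mul ha hβ]

/-! ### Lipschitz dependence of the Jost solutions -/

variable {a : ℝ} {V : ℝ → ℝ} {U : ι → ℝ → ℝ}

/-- Grönwall on `[-a, a]`: both the coefficient `V + z²` and the initial slope `z` move by `O(d)`.
-/
lemma lip_jost (hV : IsPotential a V) (hU : ∀ᶠ i in l, IsPotential a (U i))
    (hUV : ∀ᶠ i in l, ∀ x, |U i x - V x| ≤ |d i|) (hd : Tendsto d l (𝓝 0)) {z : ι → ℂ} {z₀ : ℂ}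
    (hz : (fun i => z i - z₀) =O[l] d) :
    ((fun p : ι × ℝ => jost a (U p.1) (z p.1) p.2 - jost a V z₀ p.2)
      =O[l ×ˢ 𝓟 (Set.Icc (-a) a)] fun p => d p.1) ∧
    ((fun p : ι × ℝ => jostDeriv a (U p.1) (z p.1) p.2 - jostDeriv a V z₀ p.2)
      =O[l ×ˢ 𝓟 (Set.Icc (-a) a)] fun p => d p.1) := by
  obtain ⟨Cz, hCz0, hCz⟩ := hz.exists_nonneg
  have hCz := hCz.bound
  obtain ⟨BV, hBV0, hBV⟩ := hV.exists_bound
  have hj := hV.isJost z₀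
  obtain ⟨B, hB⟩ := (isCompact_Icc (a := -a) (b := a)).exists_bound_of_continuousOn
    hj.isSol.continuous.continuousOn
  -- A common bound for the perturbed coefficients, valid once `|d i| ≤ 1` and `‖z i - z₀‖ ≤ 1`.
  set K := BV + 1 + (‖z₀‖ + 1) ^ 2 with hK
  have hK0 : 0 ≤ K := by positivity
  have hd1 : ∀ᶠ i in l, |d i| ≤ 1 := by
    have := hd.abs
    rw [abs_zero] at this
    exact this.eventually_le_const one_pos
  have hz1 : ∀ᶠ i in l, ‖z i - z₀‖ ≤ 1 := by
    have := (hz.trans_tendsto hd).norm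
    rw [norm_zero] at this
    exact this.eventually_le_const one_pos
  set C := (Cz + (1 + Cz * (2 * ‖z₀‖ + 1)) * B) * Real.exp ((1 + K) * (a - -a)) with hC
  have main : ∀ᶠ i in l, ∀ x ∈ Set.Icc (-a) a,
      ‖jost a (U i) (z i) x - jost a V z₀ x‖ ≤ C * |d i| ∧
      ‖jostDeriv a (U i) (z i) x - jostDeriv a V z₀ x‖ ≤ C * |d i| := by
    filter_upwards [hU, hUV, hd1, hz1, hCz] with i hUi hUVi hdi hzi hCzi
    rw [Real.norm_eq_abs] at hCzi
    have hji := hUi.isJost (z i)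
    have hzn : ‖z i‖ ≤ ‖z₀‖ + 1 := by
      have := norm_add_le (z i - z₀) z₀
      rw [sub_add_cancel] at this
      linarith
    have hq' : ∀ x, ‖(U i x : ℂ) + z i ^ 2‖ ≤ K := fun x => by
      refine (norm_add_le _ _).trans ?_
      rw [Complex.norm_real, Real.norm_eq_abs, norm_pow, hK]
      have h1 := hUVi x
      have h2 := hBV x
      have h3 : |U i x| ≤ |U i x - V x| + |V x| := by
        simpa using abs_add_le (U i x - V x) (V x)
      have h4 : ‖z i‖ ^ 2 ≤ (‖z₀‖ + 1) ^ 2 := by gcongr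
      linarith
    have hqq : ∀ x ∈ Set.Icc (-a) a, ‖((U i x : ℂ) + z i ^ 2) - ((V x : ℂ) + z₀ ^ 2)‖ ≤
        (1 + Cz * (2 * ‖z₀‖ + 1)) * |d i| := fun x _ => by
      have e : ((U i x : ℂ) + z i ^ 2) - ((V x : ℂ) + z₀ ^ 2) =
          ((U i x - V x : ℝ) : ℂ) + (z i - z₀) * (z i + z₀) := by push_cast; ring
      rw [e]
      refine (norm_add_le _ _).trans ?_
      rw [Complex.norm_real, Real.norm_eq_abs, norm_mul]
      have h1 := hUVi x
      have h2 : ‖z i + z₀‖ ≤ 2 * ‖z₀‖ + 1 := (norm_add_le _ _).trans (by linarith)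
      have h3 := mul_le_mul hCzi h2 (norm_nonneg _) (by positivity)
      linarith
    intro x hx
    have := hj.isSol.norm_sub_le hji.isSol hK0 hq' hB (by positivity) hqq
      (δ := Cz * |d i|) ⟨by simp [hj.left, hji.left]; positivity,
        by simpa [hj.left_deriv, hji.left_deriv] using hCzi⟩ x hx
    have e : (Cz * |d i| + (1 + Cz * (2 * ‖z₀‖ + 1)) * |d i| * B) *
        Real.exp ((1 + K) * (a - -a)) = C * |d i| := by rw [hC]; ring
    rwa [e] at this
  exact ⟨IsBigO.of_bound C (eventually_prod_principal_iff.2 (main.mono fun i hi x hx => (hi x hx).1)),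
    IsBigO.of_bound C (eventually_prod_principal_iff.2 (main.mono fun i hi x hx => (hi x hx).2))⟩

lemma lip_jost_endpoint (ha : 0 < a) (hV : IsPotential a V) (hU : ∀ᶠ i in l, IsPotential a (U i))
    (hUV : ∀ᶠ i in l, ∀ x, |U i x - V x| ≤ |d i|) (hd : Tendsto d l (𝓝 0)) {z : ι → ℂ} {z₀ : ℂ}
    (hz : (fun i => z i - z₀) =O[l] d) :
    ((fun i => jost a (U i) (z i) a - jost a V z₀ a) =O[l] d) ∧
      ((fun i => jostDeriv a (U i) (z i) a - jostDeriv a V z₀ a) =O[l] d) := by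
  have ht : Tendsto (fun i : ι => (i, a)) l (l ×ˢ 𝓟 (Set.Icc (-a) a)) :=
    tendsto_id.prodMk (tendsto_principal.2 (Eventually.of_forall fun _ => ⟨by linarith, le_rfl⟩))
  obtain ⟨h1, h2⟩ := lip_jost hV hU hUV hd hz
  exact ⟨h1.comp_tendsto ht, h2.comp_tendsto ht⟩

lemma lip_jostFun (ha : 0 < a) (hV : IsPotential a V) (hU : ∀ᶠ i in l, IsPotential a (U i))
    (hUV : ∀ᶠ i in l, ∀ x, |U i x - V x| ≤ |d i|) (hd : Tendsto d l (𝓝 0)) {z : ι → ℂ} {z₀ : ℂ}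
    (hz : (fun i => z i - z₀) =O[l] d) :
    (fun i => jostFun a (U i) (z i) - jostFun a V z₀) =O[l] d := by
  obtain ⟨h1, h2⟩ := lip_jost_endpoint ha hV hU hUV hd hz
  exact lip_add h2 (lip_mul_const hd hz h1)

lemma isBigO_one_of_continuous {g : ℝ → ℂ} (hg : Continuous g) (s t : ℝ) :
    (fun p : ι × ℝ => g p.2) =O[l ×ˢ 𝓟 (Set.Icc s t)] fun _ => (1 : ℝ) := by
  obtain ⟨B, hB⟩ := (isCompact_Icc (a := s) (b := t)).exists_bound_of_continuousOn hg.continuousOn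
  refine IsBigO.of_bound B (eventually_prod_principal_iff.2 (Eventually.of_forall fun i x hx => ?_))
  simpa using hB x hx

lemma lip_jost_mul (hV : IsPotential a V) (hU : ∀ᶠ i in l, IsPotential a (U i))
    (hUV : ∀ᶠ i in l, ∀ x, |U i x - V x| ≤ |d i|) (hd : Tendsto d l (𝓝 0)) {z w : ι → ℂ} {z₀ w₀ : ℂ}
    (hz : (fun i => z i - z₀) =O[l] d) (hw : (fun i => w i - w₀) =O[l] d) :
    (fun p : ι × ℝ => jost a (U p.1) (z p.1) p.2 * jost a (U p.1) (w p.1) p.2 -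
      jost a V z₀ p.2 * jost a V w₀ p.2) =O[l ×ˢ 𝓟 (Set.Icc (-a) a)] fun p => d p.1 :=
  lip_mul (hd.isBigO_one ℝ |>.comp_tendsto tendsto_fst) (lip_jost hV hU hUV hd hz).1
    (lip_jost hV hU hUV hd hw).1
    (isBigO_one_of_continuous (hV.isJost z₀).isSol.continuous _ _)
    (isBigO_one_of_continuous (hV.isJost w₀).isSol.continuous _ _)

end Lipschitz

/-! ### Lipschitz dependence of the bound state energy -/

section Energy

open Asymptotics

variable {a : ℝ} {V : ℝ → ℝ}

/-- Green's identity for the Jost solutions of two potentials, the second at a zero of its Jost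
function. -/
lemma IsPotential.jostFun_mul (ha : 0 < a) {U : ℝ → ℝ} (hU : IsPotential a U)
    (hV : IsPotential a V) {z z₀ : ℂ} (h0 : jostFun a V z₀ = 0) :
    jostFun a U z * jost a V z₀ a =
      (z - z₀) * (1 + jost a U z a * jost a V z₀ a +
        (z + z₀) * ∫ x in Set.Ioc (-a) a, 1 * (jost a U z x * jost a V z₀ x)) +
      ∫ x in Set.Ioc (-a) a, ((U x - V x : ℝ) : ℂ) * (jost a U z x * jost a V z₀ x) := by
  have hj := hU.isJost z
  have hj₀ := hV.isJost z₀
  have hc : Continuous fun x => jost a U z x * jost a V z₀ x :=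
    hj.isSol.continuous.mul hj₀.isSol.continuous
  have hcU := hU.continuous
  have hcV := hV.continuous
  have hcd : Continuous fun x => ((U x - V x : ℝ) : ℂ) * (jost a U z x * jost a V z₀ x) :=
    (by fun_prop : Continuous fun x => ((U x - V x : ℝ) : ℂ)).mul hc
  have hftc := intervalIntegral.integral_eq_sub_of_hasDerivAt (a := -a) (b := a)
    (fun x _ => hj.isSol.wronskian_eq hj₀.isSol x)
    (Continuous.intervalIntegrable (by fun_prop) _ _)
  rw [intervalIntegral.integral_of_le (by linarith), hj.left, hj.left_deriv, hj₀.left,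
    hj₀.left_deriv] at hftc
  have hsplit : ∫ x in Set.Ioc (-a) a, ((U x : ℂ) + z ^ 2 - ((V x : ℂ) + z₀ ^ 2)) *
      (jost a U z x * jost a V z₀ x) =
      (z ^ 2 - z₀ ^ 2) * (∫ x in Set.Ioc (-a) a, 1 * (jost a U z x * jost a V z₀ x)) +
      ∫ x in Set.Ioc (-a) a, ((U x - V x : ℝ) : ℂ) * (jost a U z x * jost a V z₀ x) := by
    rw [← integral_const_mul, ← integral_add]
    · refine integral_congr_ae (Eventually.of_forall fun x => ?_)
      dsimp only
      push_cast
      ring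
    · exact (Continuous.continuousOn (by fun_prop)).integrableOn_Icc.mono_set
        Set.Ioc_subset_Icc_self
    · exact hcd.continuousOn.integrableOn_Icc.mono_set Set.Ioc_subset_Icc_self
  rw [hsplit] at hftc
  rw [jostFun] at h0 ⊢
  linear_combination (-1 : ℂ) * hftc + jost a U z a * h0

/-- The Lipschitz estimate for a fixed potential, with `‖z - z₀‖` as the small parameter. -/
lemma IsPotential.continuous_jostFun (ha : 0 < a) (hV : IsPotential a V) :
    Continuous (jostFun a V) := by
  refine continuous_iff_continuousAt.2 fun z₀ => ?_
  have hd : Tendsto (fun z : ℂ => ‖z - z₀‖) (𝓝 z₀) (𝓝 0) := by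
    have : Continuous fun z : ℂ => ‖z - z₀‖ := by fun_prop
    simpa using this.tendsto z₀
  exact tendsto_of_lip (d := fun z => ‖z - z₀‖) (𝕜 := ℂ) hd
    (lip_jostFun (U := fun _ => V) ha hV (Eventually.of_forall fun _ => hV)
      (Eventually.of_forall fun _ x => by simp) hd (z := fun z => z)
      ((isBigO_refl (fun z : ℂ => z - z₀) _).norm_right))

lemma IsPotential.jostFun_im (hV : IsPotential a V) (κ : ℝ) :
    (jostFun a V κ).im = 0 ∧ (jost a V κ a).im = 0 := by
  obtain ⟨h1, h2⟩ := hV.conj_jost (Complex.conj_ofReal κ) a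
  rw [Complex.conj_eq_iff_im] at h1 h2
  refine ⟨?_, h1⟩
  simp [jostFun, h1, h2]

variable {ι : Type*} {l : Filter ι} {d : ι → ℝ} {U : ι → ℝ → ℝ}

/-- A zero of the Jost function persists under perturbation and moves in a Lipschitz way. -/
lemma exists_jostFun_eq_zero (ha : 0 < a) (hV : IsPotential a V)
    (hU : ∀ᶠ i in l, IsPotential a (U i))
    (hUV : ∀ᶠ i in l, ∀ x, |U i x - V x| ≤ |d i|) (hd : Tendsto d l (𝓝 0)) {κ₀ : ℝ} (hκ₀ : 0 < κ₀)
    (h0 : jostFun a V κ₀ = 0) :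
    ∃ C, ∀ᶠ i in l, ∃ κ : ℝ, |κ - κ₀| ≤ C * |d i| ∧ jostFun a (U i) κ = 0 := by
  set u₀ := jost a V κ₀ with hu₀
  -- The potential and `κ` vary jointly here, so that the Jost estimates hold uniformly for `κ` near
  -- `κ₀`.
  set D : ι × ℝ → ℝ := fun p => |d p.1| + |p.2 - κ₀| with hDdef
  have hD : Tendsto D (l ×ˢ 𝓝 κ₀) (𝓝 0) := by
    have h1 : Tendsto (fun p : ι × ℝ => |d p.1|) (l ×ˢ 𝓝 κ₀) (𝓝 0) := by
      simpa using (hd.comp tendsto_fst).abs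
    have h2 : Tendsto (fun p : ι × ℝ => |p.2 - κ₀|) (l ×ˢ 𝓝 κ₀) (𝓝 0) := by
      have : Tendsto (fun κ : ℝ => |κ - κ₀|) (𝓝 κ₀) (𝓝 0) := by
        have : Continuous fun κ : ℝ => |κ - κ₀| := by fun_prop
        simpa using this.tendsto κ₀
      exact this.comp tendsto_snd
    simpa using h1.add h2
  have hU' : ∀ᶠ p : ι × ℝ in l ×ˢ 𝓝 κ₀, IsPotential a (U p.1) := tendsto_fst.eventually hU
  have hUV' : ∀ᶠ p : ι × ℝ in l ×ˢ 𝓝 κ₀, ∀ x, |U p.1 x - V x| ≤ |D p| := by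
    filter_upwards [tendsto_fst.eventually hUV] with p hp x
    refine (hp x).trans (le_trans ?_ (le_abs_self _))
    simp [hDdef]
  have hz : (fun p : ι × ℝ => (p.2 : ℂ) - κ₀) =O[l ×ˢ 𝓝 κ₀] D := by
    refine isBigO_of_le _ fun p => ?_
    rw [← Complex.ofReal_sub, Complex.norm_real, Real.norm_eq_abs, Real.norm_eq_abs]
    refine le_trans ?_ (le_abs_self _)
    simp [hDdef]
  have hc₀ : Continuous u₀ := (hV.isJost κ₀).isSol.continuous
  have hmul : (fun q : (ι × ℝ) × ℝ => jost a (U q.1.1) q.1.2 q.2 * u₀ q.2 - u₀ q.2 * u₀ q.2)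
      =O[(l ×ˢ 𝓝 κ₀) ×ˢ 𝓟 (Set.Icc (-a) a)] fun q => D q.1 :=
    lip_mul ((hD.isBigO_one ℝ).comp_tendsto tendsto_fst)
      (lip_jost (U := fun p : ι × ℝ => U p.1) hV hU' hUV' hD hz).1
      (by simpa using isBigO_zero _ _)
      (isBigO_one_of_continuous hc₀ _ _) (isBigO_one_of_continuous hc₀ _ _)
  have hB : (fun p : ι × ℝ => (1 + jost a (U p.1) p.2 a * u₀ a + (p.2 + κ₀) *
        ∫ x in Set.Ioc (-a) a, 1 * (jost a (U p.1) p.2 x * u₀ x)) -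
      (1 + u₀ a * u₀ a + (κ₀ + κ₀) * ∫ x in Set.Ioc (-a) a, 1 * (u₀ x * u₀ x)))
      =O[l ×ˢ 𝓝 κ₀] D := by
    refine lip_add (lip_add (lip_const 1) (lip_mul_const hD
      (lip_jost_endpoint (U := fun p : ι × ℝ => U p.1) ha hV hU' hUV' hD hz).1 (lip_const _)))
      (lip_mul_const hD (lip_add hz (lip_const _)) ?_)
    refine lip_setIntegral (h := fun (p : ι × ℝ) x => jost a (U p.1) p.2 x * u₀ x)
      (memLp_top_const 1) ?_ (hc₀.mul hc₀) hmul
    filter_upwards [hU'] with p hp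
    exact (hp.isJost _).isSol.continuous.mul hc₀
  -- The slope factor in Green's identity at the base point is `1 + u₀(a)² + 2κ₀ ∫ u₀²` with `u₀`
  -- real; this makes the zero nondegenerate, and nearby the real part stays above `1/2`.
  have hB₀ : 1 ≤ (1 + u₀ a * u₀ a + (κ₀ + κ₀) *
      ∫ x in Set.Ioc (-a) a, 1 * (u₀ x * u₀ x)).re := by
    have e : ∫ x in Set.Ioc (-a) a, 1 * (u₀ x * u₀ x) =
        ((∫ x in Set.Ioc (-a) a, ‖u₀ x‖ ^ 2 : ℝ) : ℂ) := by
      rw [← integral_complex_ofReal]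
      refine integral_congr_ae (Eventually.of_forall fun x => ?_)
      simp only [one_mul]
      exact hV.jost_mul_self x
    rw [e, hV.jost_mul_self, ← Complex.ofReal_add, ← Complex.ofReal_mul, Complex.add_re,
      Complex.add_re, Complex.ofReal_re, Complex.ofReal_re, Complex.one_re]
    have : 0 ≤ ∫ x in Set.Ioc (-a) a, ‖u₀ x‖ ^ 2 := integral_nonneg fun x => by positivity
    have h2 : 0 ≤ (κ₀ + κ₀) * ∫ x in Set.Ioc (-a) a, ‖u₀ x‖ ^ 2 := by positivity
    have h3 : 0 ≤ ‖jost a V κ₀ a‖ ^ 2 := by positivity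
    linarith
  have hBre : ∀ᶠ p : ι × ℝ in l ×ˢ 𝓝 κ₀, 1 / 2 ≤ (1 + jost a (U p.1) p.2 a * u₀ a + (p.2 + κ₀) *
        ∫ x in Set.Ioc (-a) a, 1 * (jost a (U p.1) p.2 x * u₀ x)).re :=
    ((Complex.continuous_re.tendsto _).comp (tendsto_of_lip hD hB)).eventually_const_le
      (by linarith)
  have hbd : (fun q : (ι × ℝ) × ℝ => jost a (U q.1.1) q.1.2 q.2 * u₀ q.2)
      =O[(l ×ˢ 𝓝 κ₀) ×ˢ 𝓟 (Set.Icc (-a) a)] fun _ => (1 : ℝ) := by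
    have h1 := hmul.trans ((hD.isBigO_one ℝ).comp_tendsto tendsto_fst)
    have h2 : (fun q : (ι × ℝ) × ℝ => u₀ q.2 * u₀ q.2)
      =O[(l ×ˢ 𝓝 κ₀) ×ˢ 𝓟 (Set.Icc (-a) a)] fun _ => (1 : ℝ) :=
      isBigO_one_of_continuous (g := fun x => u₀ x * u₀ x) (hc₀.mul hc₀) _ _
    exact (h1.add h2).congr_left fun q => by ring
  obtain ⟨C₁, hC₁0, hC₁⟩ := exists_bound_of_isBigO_prod (d := fun _ : ι × ℝ => (1 : ℝ))
    (h := fun (p : ι × ℝ) x => jost a (U p.1) p.2 x * u₀ x) hbd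
  obtain ⟨pa, hpa, pb, hpb, hp⟩ := eventually_prod_iff.1 (hBre.and hC₁)
  obtain ⟨r, hr, hpb⟩ := Metric.eventually_nhds_iff.1 hpb
  have hu₀a : u₀ a ≠ 0 := hV.jost_ne_zero_of_jostFun_eq_zero h0
  -- The potential term in Green's identity is at most `C₁ * (2 * a) * |d i| = C * |d i| / 2`, just
  -- what a slope of at least `1/2` outweighs at distance `C * |d i|` from `κ₀`.
  set C := 2 * (C₁ * (2 * a)) with hCdef
  have hC0 : 0 ≤ C := by positivity
  have hsmall : ∀ᶠ i in l, C * |d i| < r := by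
    have : Tendsto (fun i => C * |d i|) l (𝓝 0) := by simpa using hd.abs.const_mul C
    exact this.eventually_lt_const hr
  refine ⟨C, ?_⟩
  filter_upwards [hpa, hU, hUV, hsmall] with i hpi hUi hUVi hi
  set G : ℝ → ℝ := fun κ => (jostFun a (U i) κ * u₀ a).re with hG
  have hGc : Continuous G :=
    Complex.continuous_re.comp
      (((hUi.continuous_jostFun ha).comp Complex.continuous_ofReal).mul continuous_const)
  have hGest : ∀ κ : ℝ, |κ - κ₀| ≤ C * |d i| → ∃ b e : ℝ, 1 / 2 ≤ b ∧ |e| ≤ C * |d i| / 2 ∧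
      G κ = (κ - κ₀) * b + e := fun κ hκ => by
    obtain ⟨hb, hbd⟩ := hp hpi (hpb (y := κ) (by rw [Real.dist_eq]; linarith))
    refine ⟨_, (∫ x in Set.Ioc (-a) a, ((U i x - V x : ℝ) : ℂ) *
      (jost a (U i) κ x * u₀ x)).re, hb, ?_, ?_⟩
    · refine (Complex.abs_re_le_norm _).trans ?_
      have : ‖∫ x in Set.Ioc (-a) a, ((U i x - V x : ℝ) : ℂ) * (jost a (U i) κ x * u₀ x)‖ ≤
          (|d i| * C₁) * volume.real (Set.Ioc (-a) a) := by
        refine norm_setIntegral_le_of_norm_le_const (by simp) fun x hx => ?_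
        rw [norm_mul, Complex.norm_real, Real.norm_eq_abs]
        have := hbd x (Set.Ioc_subset_Icc_self hx)
        simp only [abs_one, mul_one] at this
        exact mul_le_mul (hUVi x) this (norm_nonneg _) (abs_nonneg _)
      refine this.trans (le_of_eq ?_)
      rw [Real.volume_real_Ioc_of_le (by linarith), hCdef]
      ring
    · rw [hG]
      dsimp only
      rw [hu₀, hUi.jostFun_mul ha hV h0, Complex.add_re, ← Complex.ofReal_sub,
        Complex.re_ofReal_mul]
  set s := C * |d i| with hs
  have hs0 : 0 ≤ s := by positivity
  have hlo : G (κ₀ - s) ≤ 0 := by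
    obtain ⟨b, e, hb, he, hGe⟩ := hGest (κ₀ - s) (by rw [sub_sub_cancel_left, abs_neg, abs_of_nonneg hs0])
    rw [hGe]
    have := mul_le_mul_of_nonneg_left hb hs0
    linarith [abs_le.1 he]
  have hhi : 0 ≤ G (κ₀ + s) := by
    obtain ⟨b, e, hb, he, hGe⟩ := hGest (κ₀ + s) (by rw [add_sub_cancel_left, abs_of_nonneg hs0])
    rw [hGe]
    have := mul_le_mul_of_nonneg_left hb hs0
    linarith [abs_le.1 he]
  obtain ⟨κ, hκ, hGκ⟩ := intermediate_value_Icc (by linarith : κ₀ - s ≤ κ₀ + s)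
    hGc.continuousOn ⟨hlo, hhi⟩
  refine ⟨κ, by rw [abs_le]; constructor <;> linarith [hκ.1, hκ.2], ?_⟩
  have h3 : jostFun a (U i) κ * u₀ a = 0 := by
    refine Complex.ext hGκ ?_
    rw [Complex.mul_im, (hUi.jostFun_im κ).1, hu₀, (hV.jostFun_im κ₀).2]
    simp
  exact (mul_eq_zero.1 h3).resolve_right hu₀a

end Energy

/-! ### The squared matrix elements -/

section MatrixElement

open Asymptotics

/-- `|⟨β ψ_V, e_{V-}(·, k)⟩|²` in terms of the Jost solutions. -/
noncomputable def matrixElementSq (a : ℝ) (β V : ℝ → ℝ) (k κ : ℝ) : ℝ :=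
  ‖waveCoeff a V (-(Complex.I * k))‖ ^ 2 *
    ‖∫ x, (β x : ℂ) * (jost a V κ x * jost a V (-(Complex.I * k)) x)‖ ^ 2 /
      ∫ x, ‖jost a V κ x‖ ^ 2

variable {a : ℝ} {V : ℝ → ℝ}

/-- The arbitrary phase of the bound state drops out: its multiple of the Jost solution enters only
through its squared modulus, fixed by normalization. -/
lemma IsPotential.norm_innerL2_sq_neg_one (hV : IsPotential a V) {k κ : ℝ} (hk : k ≠ 0)
    (hκ : 0 < κ) {ψ : ℝ → ℂ} (hψ : IsNormalizedEigenfunction V (-κ ^ 2) ψ) (β : ℝ → ℝ) :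
    ‖innerL2 (fun x => (β x : ℂ) * ψ x) (distortedPlaneWave V (-1) k)‖ ^ 2 =
      matrixElementSq a β V k κ := by
  obtain ⟨h0, c, hc, hn⟩ := hV.eq_mul_jost_of_eigenfunction hκ hψ
  have e : innerL2 (fun x => (β x : ℂ) * ψ x) (distortedPlaneWave V (-1) k) =
      (conj c * waveCoeff a V (-(Complex.I * k))) *
        ∫ x, (β x : ℂ) * (jost a V κ x * jost a V (-(Complex.I * k)) x) := by
    rw [innerL2, ← integral_const_mul]
    refine integral_congr_ae (Eventually.of_forall fun x => ?_)
    simp only [hc, map_mul, Complex.conj_ofReal, (hV.conj_jost (Complex.conj_ofReal κ) x).1,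
      hV.distortedPlaneWave_neg_one hk]
    ring
  have hN : ‖c‖ ^ 2 = (∫ x, ‖jost a V κ x‖ ^ 2)⁻¹ := eq_inv_of_mul_eq_one_left hn
  rw [e, matrixElementSq, norm_mul, norm_mul, mul_pow, mul_pow, RCLike.norm_conj, hN]
  ring

lemma FermiGoldenRule.IsNormalizedEigenfunction.comp_neg {E : ℝ} {ψ : ℝ → ℂ}
    (h : IsNormalizedEigenfunction V E ψ) :
    IsNormalizedEigenfunction (fun x => V (-x)) E (fun x => ψ (-x)) := by
  obtain ⟨hs, hm, hn⟩ := h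
  have hp := Measure.measurePreserving_neg (volume : Measure ℝ)
  refine ⟨hs.comp_neg, hm.comp_measurePreserving hp, ?_⟩
  rw [← hn]
  exact eLpNorm_comp_measurePreserving hm.1 hp

lemma IsPotential.norm_innerL2_sq_one (hV : IsPotential a V) {k κ : ℝ} (hk : k ≠ 0)
    (hκ : 0 < κ) {ψ : ℝ → ℂ} (hψ : IsNormalizedEigenfunction V (-κ ^ 2) ψ) (β : ℝ → ℝ) :
    ‖innerL2 (fun x => (β x : ℂ) * ψ x) (distortedPlaneWave V 1 k)‖ ^ 2 =
      matrixElementSq a (fun x => β (-x)) (fun x => V (-x)) k κ := by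
  rw [← hV.comp_neg.norm_innerL2_sq_neg_one hk hκ hψ.comp_neg, innerL2, innerL2,
    ← integral_neg_eq_self]
  simp only [hV.distortedPlaneWave_one hk, neg_neg]

variable {ι : Type*} {l : Filter ι} {d : ι → ℝ} {U : ι → ℝ → ℝ}

lemma lip_matrixElementSq (ha : 0 < a) (hV : IsPotential a V)
    (hU : ∀ᶠ i in l, IsPotential a (U i))
    (hUV : ∀ᶠ i in l, ∀ x, |U i x - V x| ≤ |d i|) (hd : Tendsto d l (𝓝 0)) {β : ℝ → ℝ}
    (hβ : MemLp β ⊤) {k κ : ι → ℝ} {k₀ κ₀ : ℝ} (hk : (fun i => k i - k₀) =O[l] d)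
    (hκ : (fun i => κ i - κ₀) =O[l] d) (hk₀ : 0 < k₀) (hκ₀ : 0 < κ₀)
    (h0 : jostFun a V κ₀ = 0) (h0' : ∀ᶠ i in l, jostFun a (U i) (κ i) = 0) :
    (fun i => matrixElementSq a β (U i) (k i) (κ i) - matrixElementSq a β V k₀ κ₀) =O[l] d := by
  have hβ' : MemLp (fun x => (β x : ℂ)) ⊤ := hβ.ofReal
  set w : ι → ℂ := fun i => -(Complex.I * k i) with hw
  set w₀ : ℂ := -(Complex.I * k₀) with hw₀
  have hwO : (fun i => w i - w₀) =O[l] d :=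
    ((lip_ofReal.2 hk).const_mul_left (-Complex.I)).congr_left fun i => by rw [hw, hw₀]; ring
  have hκO : (fun i => (κ i : ℂ) - κ₀) =O[l] d := lip_ofReal.2 hκ
  have hw₀ne : w₀ ≠ 0 := by simp [hw₀, hk₀.ne']
  have hk_pos : ∀ᶠ i in l, 0 < k i := (tendsto_of_lip hd hk).eventually_const_lt hk₀
  have hκ_pos : ∀ᶠ i in l, 0 < κ i := (tendsto_of_lip hd hκ).eventually_const_lt hκ₀
  have h2w : (fun i => 2 * w i - 2 * w₀) =O[l] d := lip_mul_const hd (lip_const 2) hwO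
  have h2w₀ : 2 * w₀ ≠ 0 := by simpa using hw₀ne
  obtain ⟨hJκ, -⟩ := lip_jost_endpoint ha hV hU hUV hd hκO
  obtain ⟨hJw, hJw'⟩ := lip_jost_endpoint ha hV hU hUV hd hwO
  have hM := lip_jostFun ha hV hU hUV hd hwO
  have hcoeff : (fun i => waveCoeff a (U i) (w i) - waveCoeff a V w₀) =O[l] d := by
    refine lip_div hd (lip_mul_const hd h2w ?_) hM (hV.jostFun_ne_zero hk₀.ne')
    exact lip_comp hd Complex.differentiableAt_exp (lip_mul_const hd hwO (lip_const _))
  have hadd := lip_add hκO hwO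
  have hI : (fun i => (∫ x, (β x : ℂ) * (jost a (U i) (κ i) x * jost a (U i) (w i) x)) -
      ∫ x, (β x : ℂ) * (jost a V κ₀ x * jost a V w₀ x)) =O[l] d := by
    refine lip_integral ha.le hβ' hd ?_
      (hV.hasExpTails_mul h0 hw₀ne (by simpa using hκ₀) (by simpa [hw₀] using hκ₀)
        (by simpa [hw₀] using hκ₀))
      (lip_jost_mul hV hU hUV hd hκO hwO) hadd
      (lip_mul_const hd hJκ (lip_div hd hM h2w h2w₀)) (lip_sub hκO hwO)
      (lip_mul_const hd hJκ
        (lip_div hd (lip_sub (lip_mul_const hd hwO hJw) hJw') h2w h2w₀)) hadd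
    filter_upwards [hU, h0', hk_pos, hκ_pos] with i hUi h0i hki hκi
    exact hUi.hasExpTails_mul h0i (by simp [hw, hki.ne']) (by simpa using hκi)
      (by simpa [hw] using hκi) (by simpa [hw] using hκi)
  have hN : (fun i => (∫ x, ‖jost a (U i) (κ i) x‖ ^ 2) - ∫ x, ‖jost a V κ₀ x‖ ^ 2) =O[l] d := by
    have e : ∀ {W : ℝ → ℝ} {κ : ℝ}, IsPotential a W → ((∫ x, ‖jost a W κ x‖ ^ 2 : ℝ) : ℂ) =
        ∫ x, (1 : ℂ) * (jost a W κ x * jost a W κ x) := fun hW => by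
      rw [← integral_complex_ofReal]
      simp only [one_mul]
      exact integral_congr_ae (Eventually.of_forall fun x => (hW.jost_mul_self x).symm)
    have h2κ : (fun i => 2 * (κ i : ℂ) - 2 * κ₀) =O[l] d := lip_mul_const hd (lip_const 2) hκO
    have := lip_integral ha.le (memLp_top_const (1 : ℂ)) hd
      (H := by
        filter_upwards [hU, h0', hκ_pos] with i hUi h0i hκi
        exact hUi.hasExpTails_sq h0i (by simpa using hκi))
      (hV.hasExpTails_sq h0 (by simpa using hκ₀)) (lip_jost_mul hV hU hUV hd hκO hκO) h2κ
      (lip_mul_const hd hJκ hJκ) h2κ (lip_const 0) h2κ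
    rw [← lip_ofReal]
    refine this.congr' ?_ EventuallyEq.rfl
    filter_upwards [hU] with i hUi
    rw [e hUi, e hV]
  exact lip_div hd (lip_mul_const hd (lip_norm_sq hd hcoeff) (lip_norm_sq hd hI)) hN
    (hV.integral_norm_sq_pos hκ₀ h0).ne'

end MatrixElement

/-! ### Potentials with a single bound state -/

/-- Continuous potentials supported in `[-a, a]`, with exactly one negative eigenvalue, which is
above `-μ`. -/
structure HasBoundState (a μ : ℝ) (V : ℝ → ℝ) : Prop where
  isPotential : IsPotential a V
  existsUnique : ∃! E : ℝ, E < 0 ∧ IsEigenvalue V E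
  resonance : 0 < boundEnergy V + μ

lemma FermiGoldenRule.Admissible.hasBoundState {a b μ a' : ℝ} {V : ℝ → ℝ}
    (h : Admissible a b μ V) (ha : a ≤ a') : HasBoundState a' μ V :=
  ⟨⟨h.continuous, fun x hx => h.support x (ha.trans_lt hx)⟩, h.oneBoundState, h.resonance⟩

/-- The decay rate of the bound state. -/
noncomputable def decayRate (V : ℝ → ℝ) : ℝ := Real.sqrt (-boundEnergy V)

section

variable {a μ : ℝ} {V : ℝ → ℝ}

lemma HasBoundState.boundEnergy_spec (h : HasBoundState a μ V) :
    boundEnergy V < 0 ∧ IsEigenvalue V (boundEnergy V) :=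
  Classical.epsilon_spec (p := fun E : ℝ => E < 0 ∧ IsEigenvalue V E) h.existsUnique.exists

lemma HasBoundState.decayRate_pos (h : HasBoundState a μ V) : 0 < decayRate V :=
  Real.sqrt_pos.2 (by linarith [h.boundEnergy_spec.1])

lemma HasBoundState.boundEnergy_eq (h : HasBoundState a μ V) :
    boundEnergy V = -decayRate V ^ 2 := by
  rw [decayRate, Real.sq_sqrt (by linarith [h.boundEnergy_spec.1]), neg_neg]

lemma HasBoundState.boundState_spec (h : HasBoundState a μ V) :
    IsNormalizedEigenfunction V (-decayRate V ^ 2) (boundState V) := by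
  rw [← h.boundEnergy_eq]
  exact Classical.epsilon_spec
    (p := fun ψ : ℝ → ℂ => IsNormalizedEigenfunction V (boundEnergy V) ψ) h.boundEnergy_spec.2

lemma HasBoundState.jostFun_eq_zero (h : HasBoundState a μ V) : jostFun a V (decayRate V) = 0 :=
  (h.isPotential.eq_mul_jost_of_eigenfunction h.decayRate_pos h.boundState_spec).1

lemma HasBoundState.jostFun_comp_neg_eq_zero (h : HasBoundState a μ V) :
    jostFun a (fun x => V (-x)) (decayRate V) = 0 :=
  (h.isPotential.comp_neg.eq_mul_jost_of_eigenfunction h.decayRate_pos h.boundState_spec.comp_neg).1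

/-- Uniqueness of the negative eigenvalue ties any positive zero of the Jost function, in particular
one found by perturbation, to the bound state. -/
lemma HasBoundState.eq_decayRate (h : HasBoundState a μ V) {κ : ℝ} (hκ : 0 < κ)
    (h0 : jostFun a V κ = 0) : κ = decayRate V := by
  have e := h.existsUnique.unique ⟨by nlinarith, h.isPotential.isEigenvalue hκ h0⟩
    h.boundEnergy_spec
  rw [decayRate, ← e, neg_neg, Real.sqrt_sq hκ.le]

lemma HasBoundState.resonantK_pos (h : HasBoundState a μ V) : 0 < resonantK μ V :=
  Real.sqrt_pos.2 h.resonance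

lemma HasBoundState.gam_eq (h : HasBoundState a μ V) (β : ℝ → ℝ) :
    Gam β μ V = 1 / (16 * resonantK μ V) *
      (matrixElementSq a (fun x => β (-x)) (fun x => V (-x)) (resonantK μ V) (decayRate V) +
        matrixElementSq a β V (resonantK μ V) (decayRate V)) := by
  rw [Gam, h.isPotential.norm_innerL2_sq_one h.resonantK_pos.ne' h.decayRate_pos h.boundState_spec,
    h.isPotential.norm_innerL2_sq_neg_one h.resonantK_pos.ne' h.decayRate_pos h.boundState_spec]

open Asymptotics

variable {ι : Type*} {l : Filter ι} {d : ι → ℝ} {U : ι → ℝ → ℝ}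

lemma lip_decayRate (ha : 0 < a) (hV : HasBoundState a μ V) (hU : ∀ᶠ i in l, HasBoundState a μ (U i))
    (hUV : ∀ᶠ i in l, ∀ x, |U i x - V x| ≤ |d i|) (hd : Tendsto d l (𝓝 0)) :
    (fun i => decayRate (U i) - decayRate V) =O[l] d := by
  obtain ⟨C, hC⟩ := exists_jostFun_eq_zero ha hV.isPotential (hU.mono fun i hi => hi.isPotential)
    hUV hd hV.decayRate_pos hV.jostFun_eq_zero
  have hsmall : ∀ᶠ i in l, C * |d i| < decayRate V := by
    have : Tendsto (fun i => C * |d i|) l (𝓝 0) := by simpa using hd.abs.const_mul C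
    exact this.eventually_lt_const hV.decayRate_pos
  refine IsBigO.of_bound C ?_
  filter_upwards [hC, hU, hsmall] with i ⟨κ, hκ, h0⟩ hUi hi
  have hκ_pos : 0 < κ := by linarith [(abs_le.1 hκ).1]
  rwa [← hUi.eq_decayRate hκ_pos h0]

/-- Lipschitz dependence of `Γ` on the potential along families with a single bound state. -/
lemma lip_gam (ha : 0 < a) (hV : HasBoundState a μ V) (hU : ∀ᶠ i in l, HasBoundState a μ (U i))
    (hUV : ∀ᶠ i in l, ∀ x, |U i x - V x| ≤ |d i|) (hd : Tendsto d l (𝓝 0)) {β : ℝ → ℝ}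
    (hβ : MemLp β ⊤) : (fun i => Gam β μ (U i) - Gam β μ V) =O[l] d := by
  have hκ := lip_decayRate ha hV hU hUV hd
  have hk : (fun i => resonantK μ (U i) - resonantK μ V) =O[l] d := by
    have h1 : (fun i => boundEnergy (U i) + μ - (boundEnergy V + μ)) =O[l] d := by
      refine (lip_mul_const hd hκ hκ).neg_left.congr' ?_ EventuallyEq.rfl
      filter_upwards [hU] with i hUi
      rw [hUi.boundEnergy_eq, hV.boundEnergy_eq]
      ring
    -- The square root is differentiable here because the resonance condition keeps `boundEnergy V +
    -- μ` away from zero.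
    exact lip_comp hd (Real.hasDerivAt_sqrt hV.resonance.ne').differentiableAt h1
  have hP := hU.mono fun i hi => hi.isPotential
  have hm := lip_matrixElementSq ha hV.isPotential hP hUV hd hβ hk hκ hV.resonantK_pos
    hV.decayRate_pos hV.jostFun_eq_zero (hU.mono fun i hi => hi.jostFun_eq_zero)
  have hp := lip_matrixElementSq (U := fun i x => U i (-x)) ha hV.isPotential.comp_neg
    (hP.mono fun i hi => hi.comp_neg) (hUV.mono fun i hi x => hi (-x)) hd
    (hβ.comp_measurePreserving (Measure.measurePreserving_neg _)) hk hκ hV.resonantK_pos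
    hV.decayRate_pos hV.jostFun_comp_neg_eq_zero (hU.mono fun i hi => hi.jostFun_comp_neg_eq_zero)
  have h16 : 16 * resonantK μ V ≠ 0 := by simpa using hV.resonantK_pos.ne'
  refine (lip_mul_const hd (lip_div hd (lip_const 1) (lip_mul_const hd (lip_const 16) hk) h16)
    (lip_add hp hm)).congr' ?_ EventuallyEq.rfl
  filter_upwards [hU] with i hUi
  rw [hUi.gam_eq, hV.gam_eq]
  rfl

end

/-! ### Essential supremum of continuous functions and the main theorem -/

/-- The almost everywhere bound holds on a set that is dense, and closed by continuity. -/
lemma abs_le_toReal_eLpNorm_top {f : ℝ → ℝ} (hf : Continuous f) (hfin : eLpNorm f ⊤ volume ≠ ⊤)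
    (x : ℝ) : |f x| ≤ (eLpNorm f ⊤ volume).toReal := by
  rw [eLpNorm_exponent_top] at hfin ⊢
  have hae : ∀ᵐ y, |f y| ≤ (eLpNormEssSup f volume).toReal := by
    filter_upwards [ae_le_eLpNormEssSup (f := f) (μ := volume)] with y hy
    rw [← Real.norm_eq_abs, ← toReal_enorm]
    exact ENNReal.toReal_mono hfin hy
  have hcl : IsClosed {y | |f y| ≤ (eLpNormEssSup f volume).toReal} :=
    isClosed_le hf.abs continuous_const
  have huniv := (Measure.dense_of_ae hae).closure_eq
  rw [hcl.closure_eq] at huniv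
  exact huniv.ge (Set.mem_univ x)

lemma IsPotential.eLpNorm_sub_ne_top {a : ℝ} {U V : ℝ → ℝ} (hU : IsPotential a U)
    (hV : IsPotential a V) : eLpNorm (U - V) ⊤ volume ≠ ⊤ := by
  obtain ⟨B, -, hB⟩ := hU.exists_bound
  obtain ⟨B', -, hB'⟩ := hV.exists_bound
  refine (memLp_top_of_bound (hU.continuous.sub hV.continuous).aestronglyMeasurable (B + B')
    (Eventually.of_forall fun x => ?_)).2.ne
  exact (norm_sub_le _ _).trans (add_le_add (hB x) (hB' x))

theorem mainTheorem4 (β : ℝ → ℝ) (hβ : MeasureTheory.MemLp β ⊤ MeasureTheory.volume)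
    (a μ : ℝ) (V : ℝ → ℝ) :
    ∃ ρ₀ : ℝ, 0 < ρ₀ ∧ ∃ C : ℝ, ∀ b δ : ℝ, 0 < δ →
      FermiGoldenRule.AdmissibleReg δ a b μ V →
      ∀ U : ℝ → ℝ, FermiGoldenRule.AdmissibleReg δ a b μ U →
        MeasureTheory.eLpNorm (U - V) ⊤ MeasureTheory.volume < ENNReal.ofReal ρ₀ →
        |FermiGoldenRule.Gam β μ U - FermiGoldenRule.Gam β μ V| ≤
          C * (MeasureTheory.eLpNorm (U - V) ⊤ MeasureTheory.volume).toReal := by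
  -- The radius and constant precede `b` and `δ`, so the case split uses a property free of both; if
  -- it fails, no admissibility hypothesis can hold. Enlarging `a` to `|a| + 1` makes the support
  -- radius positive.
  by_cases hV : HasBoundState (|a| + 1) μ V
  swap
  · refine ⟨1, one_pos, 0, fun b δ _ hVadm => absurd (hVadm.1.hasBoundState ?_) hV⟩
    linarith [le_abs_self a]
  have ha : 0 < |a| + 1 := by positivity
  set d : (ℝ → ℝ) → ℝ := fun U => (eLpNorm (U - V) ⊤ volume).toReal
  -- Restricting to potentials with a bound state also excludes functions at infinite distance, for
  -- which `toReal` would give `d U = 0`.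
  have hd : Tendsto d (comap d (𝓝 0) ⊓ 𝓟 {U | HasBoundState (|a| + 1) μ U}) (𝓝 0) :=
    tendsto_comap.mono_left inf_le_left
  have hU : ∀ᶠ U in comap d (𝓝 0) ⊓ 𝓟 {U | HasBoundState (|a| + 1) μ U},
      HasBoundState (|a| + 1) μ U := eventually_inf_principal.2 (Eventually.of_forall fun _ h => h)
  have hUV : ∀ᶠ U in comap d (𝓝 0) ⊓ 𝓟 {U | HasBoundState (|a| + 1) μ U},
      ∀ x, |U x - V x| ≤ |d U| := by
    filter_upwards [hU] with U hU x
    exact (abs_le_toReal_eLpNorm_top (hU.isPotential.continuous.sub hV.isPotential.continuous)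
      (hU.isPotential.eLpNorm_sub_ne_top hV.isPotential) x).trans (le_abs_self _)
  obtain ⟨C, hC⟩ := (lip_gam (U := fun U => U) ha hV hU hUV hd hβ).bound
  obtain ⟨ρ, hρ, h⟩ := Metric.eventually_nhds_iff.1
    (eventually_comap.1 (eventually_inf_principal.1 hC))
  refine ⟨ρ, hρ, C, fun b δ _ _ U hUadm hlt => ?_⟩
  have hUb : HasBoundState (|a| + 1) μ U :=
    hUadm.1.hasBoundState (by linarith [le_abs_self a])
  have hdist : dist (d U) 0 < ρ := by
    rw [Real.dist_eq, sub_zero, abs_of_nonneg ENNReal.toReal_nonneg]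
    exact ENNReal.toReal_lt_of_lt_ofReal hlt
  have := h hdist U rfl hUb
  rwa [Real.norm_eq_abs, Real.norm_of_nonneg ENNReal.toReal_nonneg] at this
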